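/- Let $\mathcal{SO}(d)$ be the group of orthogonal $d\times d$ real matrices of determinant one, and for $Z,Z^*\in\mathcal{SO}(d)^n$ let $$\bar\ell(Z,Z^*)=\min_{B\in\mathcal{SO}(d)}\frac1n\sum_{i=1}^n\|Z_i-Z_i^*B\|_F^2 .$$ Let $n\ge 1$, $\sigma>0$, $p\in[0,1]$. For $Z\in\mathcal{SO}(d)^n$ let $\mathbb{E}_Z$ be the expectation when the data are $(A_{ij},A_{ij}Y_{ij})_{1\le i<j\le n}$, where $Y_{ij}=Z_iZ_j^{T}+\sigma W_{ij}$, the $A_{ij}$ are Bernoulli$(p)$ variables, the $W_{ij}$ are $d\times d$ matrices with independent standard normal entries, and all the $A_{ij}$ and $W_{ij}$, $i<j$, are independent. There is a constant $c>0$ such that for every $C_1>0$ there is a constant $C>0$, depending only on $C_1$, such that, whenever $\frac{np}{\sigma^2}\ge c$ and $2\le d\le C_1$, $$\inf_{\widehat Z}\ \sup_{Z\in\mathcal{SO}(d)^n}\mathbb{E}_Z\,\bar\ell(\widehat Z,Z)\ \ge\ \left(1-C\left(\frac1n+\frac{\sigma^2}{np}\right)\right)\frac{\sigma^2d(d-1)}{2np},$$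 where the infimum is over all estimators $\widehat Z\in\mathcal{SO}(d)^n$ based on the data (measurable functions of the data, possibly with additional independent randomization). -/

import Mathlib

open MeasureTheory ProbabilityTheory

noncomputable section

namespace RotSync

/-- The product (that is, Borel) `σ`-algebra on real matrices. -/
instance matrixMeasurableSpace {m k : Type*} : MeasurableSpace (Matrix m k ℝ) :=
  inferInstanceAs (MeasurableSpace (m → k → ℝ))

/-- The rotation group `SO(d)`, as the type of orthogonal `d × d` matrices of determinant one. -/
abbrev SO (d : ℕ) : Type := Matrix.specialOrthogonalGroup (Fin d) ℝ

/-- The squared Frobenius norm. -/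
def frobSq {d : ℕ} (M : Matrix (Fin d) (Fin d) ℝ) : ℝ := ∑ a, ∑ b, M a b ^ 2

/-- The loss `min_{B ∈ SO(d)} (1/n) ∑ᵢ ‖Zᵢ - Zᵢ* B‖_F²`; the first argument is `Z`, the second
is `Z*`. The minimum over the compact nonempty set `SO(d)` is written as an infimum. -/
def loss {n d : ℕ} (Z Zs : Fin n → SO d) : ℝ :=
  ⨅ B : SO d, (1 / (n : ℝ)) *
    ∑ i, frobSq ((Z i : Matrix (Fin d) (Fin d) ℝ) -
      (Zs i : Matrix (Fin d) (Fin d) ℝ) * (B : Matrix (Fin d) (Fin d) ℝ))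

/-- The pairs `(i, j)` of vertices with `i < j`. -/
abbrev Pairs (n : ℕ) : Type := {e : Fin n × Fin n // e.1 < e.2}

/-- The standard matrix Gaussian law `MN(0, I_d, I_d)`, with density proportional to
`exp (-Tr(XᵀX)/2)`: the entries are independent standard normal variables. -/
def stdGaussianMatrix (d : ℕ) : Measure (Matrix (Fin d) (Fin d) ℝ) :=
  Measure.pi fun _ : Fin d => Measure.pi fun _ : Fin d => gaussianReal 0 1

/-- A realization of the randomness: the edge indicators `A_{ij}` and the noise matrices `W_{ij}`,
for `i < j`. -/
abbrev Noise (n d : ℕ) : Type := Pairs n → Bool × Matrix (Fin d) (Fin d) ℝ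

/-- The joint law of `(A_{ij}, W_{ij})`, `i < j`: all of them are independent, with
`A_{ij} ∼ Bernoulli(p)` and `W_{ij} ∼ MN(0, I_d, I_d)`. -/
def noiseLaw (n d : ℕ) (p : unitInterval) : Measure (Noise n d) :=
  Measure.pi fun _ => (bernoulliMeasure true false p).prod (stdGaussianMatrix d)

/-- The data: for each `i < j`, the edge indicator `A_{ij}` and the matrix `A_{ij} Y_{ij}`. -/
abbrev Obs (n d : ℕ) : Type := Pairs n → Bool × Matrix (Fin d) (Fin d) ℝ

/-- The data `(A_{ij}, A_{ij} Y_{ij})`, `i < j`, with `Y_{ij} = Zᵢ Zⱼᵀ + σ W_{ij}`. -/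
def observe {n d : ℕ} (σ : ℝ) (Z : Fin n → SO d) (ω : Noise n d) : Obs n d :=
  fun e => ((ω e).1,
    if (ω e).1 then
      (Z e.1.1 : Matrix (Fin d) (Fin d) ℝ) * (Z e.1.2 : Matrix (Fin d) (Fin d) ℝ).transpose
        + σ • (ω e).2
    else 0)

theorem measurable_observe {n d : ℕ} (σ : ℝ) :
    Measurable fun q : (Fin n → SO d) × Noise n d => observe σ q.1 q.2 := by
  refine measurable_pi_lambda _ fun e => ?_
  have hω : Measurable fun q : (Fin n → SO d) × Noise n d => q.2 e :=
    (measurable_pi_apply e).comp measurable_snd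
  have hZ : ∀ (i : Fin n) (a b : Fin d), Measurable fun q : (Fin n → SO d) × Noise n d =>
      (q.1 i : Matrix (Fin d) (Fin d) ℝ) a b := fun i a b =>
    (measurable_pi_apply b).comp ((measurable_pi_apply a).comp
      (measurable_subtype_coe.comp ((measurable_pi_apply i).comp measurable_fst)))
  refine hω.fst.prodMk (Measurable.ite (hω.fst (measurableSet_singleton true)) ?_
    measurable_const)
  refine measurable_pi_lambda _ fun a => measurable_pi_lambda _ fun b => ?_
  have hW : Measurable fun q : (Fin n → SO d) × Noise n d => (q.2 e).2 a b :=
    (measurable_pi_apply b).comp ((measurable_pi_apply a).comp hω.snd)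
  simp only [Matrix.add_apply, Matrix.mul_apply, Matrix.transpose_apply, Matrix.smul_apply,
    smul_eq_mul]
  exact (Finset.measurable_sum _ fun c _ => (hZ _ a c).mul (hZ _ b c)).add (hW.const_mul σ)

instance isProbabilityMeasure_noiseLaw (n d : ℕ) (p : unitInterval) :
    IsProbabilityMeasure (noiseLaw n d p) := by
  have : IsProbabilityMeasure (stdGaussianMatrix d) := by
    unfold stdGaussianMatrix
    exact Measure.pi.instIsProbabilityMeasure _
  unfold noiseLaw
  infer_instance

/-- The statistical model: `Z ∈ SO(d)ⁿ` is sent to the law of the data under `Z`. -/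
def model (n d : ℕ) (σ : ℝ) (p : unitInterval) : Kernel (Fin n → SO d) (Obs n d) where
  toFun Z := (noiseLaw n d p).map (observe σ Z)
  measurable' := by
    have h : (fun Z : Fin n → SO d => (noiseLaw n d p).map (observe σ Z)) =
        fun Z => ((Measure.dirac Z).prod (noiseLaw n d p)).map
          (fun q : (Fin n → SO d) × Noise n d => observe σ q.1 q.2) := by
      funext Z
      rw [Measure.dirac_prod, Measure.map_map (measurable_observe σ) measurable_prodMk_left]
      rfl
    rw [h]
    refine (Measure.measurable_map _ (measurable_observe σ)).comp ?_
    have h2 := Kernel.measurable (Kernel.id ×ₖ Kernel.const (Fin n → SO d) (noiseLaw n d p))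
    convert h2 using 1
    funext Z
    rw [Kernel.prod_apply, Kernel.id_apply, Kernel.const_apply]

/-- The minimax risk for the loss above: the infimum over all estimators with values in `SO(d)ⁿ`
(Markov kernels from the data, which include the measurable functions of the data) of the supremum
over `Z ∈ SO(d)ⁿ` of the expected loss. -/
def risk (n d : ℕ) (σ : ℝ) (p : unitInterval) : ENNReal :=
  minimaxRisk (fun Z Zhat : Fin n → SO d => ENNReal.ofReal (loss Zhat Z)) (model n d σ p)

end RotSync

end

/-! The bound is a van Trees inequality under the Haar prior, with difference quotients in place of
derivatives. Write x = σ²/(np).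

The global rotation B is removed first: the loss is at least half the average over (i, j) of |ẐᵢẐⱼᵀ
- ZᵢZⱼᵀ|² (`pairLoss_le_loss`), so it suffices to bound the risk for each ZᵢZⱼᵀ. Fix i ≠ j and
rotate the vertices i and j by t and -t in a coordinate plane k. The data see this as a translation
of the Gaussian noise on the edges present (`observe_mul_rotatePair`), so likelihood ratios and
their second moments are explicit. Opposite directions are efficient: ZᵢZⱼᵀ moves at speed 2 while
the squared relative speeds over all edges sum to 2n (`sum_speed_sub_speed_sq`); moving i alone
would give about half the bound.

For any test matrix G, |X|² ≥ 2c⟨X, G⟩ - c²|G|². Take X the error and G the sum over k of the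
difference quotients of likelihood times tangent vector. Then E⟨X, G⟩ is the constant `testMean`
plus increments of functions of Z along the rotations (`integral_frobInner_error_testMatrix`), and
E|G|² is `testMoment`, free of Z. Averaging over a right-invariant law kills the increments, for all
pairs at once (`exists_stepBound_le`). As t → 0 the two constants tend to 4d(d-1) and
16d(d-1)(1+(d-1)x)/x. The best c gives (1-1/n) d(d-1)x / (2(1+(d-1)x)), and the two correction
factors are absorbed into C. -/

noncomputable section

namespace RotSync

/-! ### Densities of product measures under coordinatewise maps -/

section Pi

variable {ι : Type*} [Fintype ι] {X : ι → Type*} [∀ i, MeasurableSpace (X i)]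
  (μ : ∀ i, Measure (X i)) [∀ i, IsProbabilityMeasure (μ i)]

theorem lintegral_pi_prod {f : ∀ i, X i → ENNReal} (hf : ∀ i, Measurable (f i)) :
    ∫⁻ x, ∏ i, f i (x i) ∂Measure.pi μ = ∏ i, ∫⁻ x, f i x ∂μ i := by
  have hind : iIndepFun (fun i (x : ∀ i, X i) => f i (x i)) (Measure.pi μ) :=
    iIndepFun_pi fun i => (hf i).aemeasurable
  have h := lintegral_prod_eq_prod_lintegral_of_indepFun (μ := Measure.pi μ) Finset.univ
    (fun i (x : ∀ i, X i) => f i (x i)) hind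
    fun i => (hf i).comp (measurable_pi_apply i)
  refine h.trans (Finset.prod_congr rfl fun i _ => ?_)
  exact (measurePreserving_eval μ i).lintegral_comp (hf i)

/-- The push-forward is again a product measure, hence determined by its values on measurable boxes;
there the density, cut off by indicators, factorizes over the coordinates. -/
theorem pi_map_eq_withDensity {s : ∀ i, X i → X i} (hs : ∀ i, Measurable (s i))
    {r : ∀ i, X i → ℝ} (hr : ∀ i, Measurable (r i)) (hr0 : ∀ i x, 0 ≤ r i x)
    (h : ∀ i, (μ i).map (s i) = (μ i).withDensity fun x => ENNReal.ofReal (r i x)) :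
    (Measure.pi μ).map (fun x i => s i (x i)) =
      (Measure.pi μ).withDensity fun x => ENNReal.ofReal (∏ i, r i (x i)) := by
  have hp : ∀ i, IsProbabilityMeasure ((μ i).map (s i)) := fun i =>
    Measure.isProbabilityMeasure_map (hs i).aemeasurable
  rw [Measure.pi_map_pi fun i => (hs i).aemeasurable]
  refine Measure.pi_eq fun t ht => ?_
  rw [withDensity_apply _ (MeasurableSet.univ_pi ht),
    ← lintegral_indicator (MeasurableSet.univ_pi ht)]
  have hprod : ∀ x : ∀ i, X i,
      (Set.univ.pi t).indicator (fun x => ENNReal.ofReal (∏ i, r i (x i))) x =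
        ∏ i, (t i).indicator (fun y => ENNReal.ofReal (r i y)) (x i) := by
    intro x
    by_cases hx : x ∈ Set.univ.pi t
    · rw [Set.indicator_of_mem hx, ENNReal.ofReal_prod_of_nonneg fun i _ => hr0 i _]
      exact Finset.prod_congr rfl fun i _ => by rw [Set.indicator_of_mem (hx i trivial)]
    · rw [Set.indicator_of_notMem hx]
      obtain ⟨i, hi⟩ : ∃ i, x i ∉ t i := by simpa [Set.mem_pi] using hx
      exact (Finset.prod_eq_zero (Finset.mem_univ i) (Set.indicator_of_notMem hi _)).symm
  simp_rw [hprod]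
  rw [lintegral_pi_prod μ fun i => ((hr i).ennreal_ofReal).indicator (ht i)]
  refine Finset.prod_congr rfl fun i _ => ?_
  rw [lintegral_indicator (ht i), h i, withDensity_apply _ (ht i)]

end Pi

/-! ### Likelihood ratios of Gaussian translations on random edges -/

/-- The Frobenius inner product of two real matrices. -/
def frobInner {d : ℕ} (X Y : Matrix (Fin d) (Fin d) ℝ) : ℝ := ∑ a, ∑ b, X a b * Y a b

theorem gaussianReal_map_add_eq_withDensity (h : ℝ) :
    (gaussianReal 0 1).map (fun x => x + h) =
      (gaussianReal 0 1).withDensity fun x => ENNReal.ofReal (Real.exp (h * x - h * h / 2)) := by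
  rw [gaussianReal_map_add_const, gaussianReal_of_var_ne_zero _ one_ne_zero,
    gaussianReal_of_var_ne_zero _ one_ne_zero, ← withDensity_mul _ (measurable_gaussianPDF _ _)
      (by fun_prop)]
  congr 1
  funext x
  simp only [gaussianPDF, Pi.mul_apply, gaussianPDFReal]
  rw [← ENNReal.ofReal_mul (by positivity), mul_assoc (√(2 * Real.pi * _))⁻¹, ← Real.exp_add]
  congr 3
  simp
  ring

/-- The integrand is a constant times exp((h+k)x), so the Gaussian moment generating function
applies. The product hk is what turns second moments of likelihood ratios into inner products of
translations. -/
theorem integral_exp_mul_exp_gaussianReal (h k : ℝ) :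
    ∫ x, Real.exp (h * x - h * h / 2) * Real.exp (k * x - k * k / 2) ∂gaussianReal 0 1 =
      Real.exp (h * k) := by
  have hm := mgf_gaussianReal (μ := 0) (v := 1) (p := gaussianReal 0 1) (X := id) (by simp) (h + k)
  have hx : ∀ x : ℝ, Real.exp (h * x - h * h / 2) * Real.exp (k * x - k * k / 2) =
      Real.exp (-(h * h / 2) - k * k / 2) * Real.exp ((h + k) * x) := by
    intro x
    rw [← Real.exp_add, ← Real.exp_add]
    ring_nf
  simp_rw [hx]
  rw [integral_const_mul]
  simp only [mgf, id] at hm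
  rw [hm, ← Real.exp_add]
  congr 1
  push_cast
  ring

/-- The density of the standard Gaussian matrix translated by `h` with respect to the standard
Gaussian matrix. -/
def shiftDensity {d : ℕ} (h W : Matrix (Fin d) (Fin d) ℝ) : ℝ :=
  Real.exp (frobInner h W - frobInner h h / 2)

theorem shiftDensity_eq_prod {d : ℕ} (h W : Matrix (Fin d) (Fin d) ℝ) :
    shiftDensity h W = ∏ a, ∏ b, Real.exp (h a b * W a b - h a b * h a b / 2) := by
  simp only [shiftDensity, frobInner, ← Real.exp_sum, Finset.sum_sub_distrib, Finset.sum_div]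

instance isProbabilityMeasure_stdGaussianMatrix (d : ℕ) :
    IsProbabilityMeasure (stdGaussianMatrix d) := by
  unfold stdGaussianMatrix
  exact Measure.pi.instIsProbabilityMeasure _

theorem measurable_entry {d : ℕ} (a b : Fin d) :
    Measurable fun M : Matrix (Fin d) (Fin d) ℝ => M a b :=
  (measurable_pi_apply b).comp (measurable_pi_apply a)

theorem measurable_matrix {α : Type*} [MeasurableSpace α] {d : ℕ}
    {f : α → Matrix (Fin d) (Fin d) ℝ} (h : ∀ a b, Measurable fun x => f x a b) :
    Measurable f :=
  measurable_pi_lambda _ fun a => measurable_pi_lambda _ fun b => h a b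

theorem measurable_frobInner {α : Type*} [MeasurableSpace α] {d : ℕ}
    {f g : α → Matrix (Fin d) (Fin d) ℝ} (hf : Measurable f) (hg : Measurable g) :
    Measurable fun x => frobInner (f x) (g x) :=
  Finset.measurable_sum _ fun a _ => Finset.measurable_sum _ fun b _ =>
    ((measurable_entry a b).comp hf).mul ((measurable_entry a b).comp hg)

theorem measurable_shiftDensity {d : ℕ} (h : Matrix (Fin d) (Fin d) ℝ) :
    Measurable (shiftDensity h) :=
  ((measurable_frobInner measurable_const measurable_id).sub_const _).exp

theorem stdGaussianMatrix_map_add {d : ℕ} (h : Matrix (Fin d) (Fin d) ℝ) :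
    (stdGaussianMatrix d).map (fun W => W + h) =
      (stdGaussianMatrix d).withDensity fun W => ENNReal.ofReal (shiftDensity h W) := by
  have hrow : ∀ a : Fin d, (Measure.pi fun _ : Fin d => gaussianReal 0 1).map
      (fun (w : Fin d → ℝ) b => w b + h a b) =
        (Measure.pi fun _ : Fin d => gaussianReal 0 1).withDensity fun w =>
          ENNReal.ofReal (∏ b, Real.exp (h a b * w b - h a b * h a b / 2)) := fun a =>
    pi_map_eq_withDensity (fun _ : Fin d => gaussianReal 0 1)
      (s := fun b x => x + h a b) (fun b => by fun_prop)
      (r := fun b x => Real.exp (h a b * x - h a b * h a b / 2)) (fun b => by fun_prop)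
      (fun b x => (Real.exp_pos _).le) fun b => gaussianReal_map_add_eq_withDensity (h a b)
  have hmat := pi_map_eq_withDensity (fun _ : Fin d => Measure.pi fun _ : Fin d => gaussianReal 0 1)
      (s := fun a (w : Fin d → ℝ) b => w b + h a b) (fun a => by fun_prop)
      (r := fun a w => ∏ b, Real.exp (h a b * w b - h a b * h a b / 2)) (fun a => by fun_prop)
      (fun a w => Finset.prod_nonneg fun b _ => (Real.exp_pos _).le) hrow
  simp_rw [shiftDensity_eq_prod]
  exact hmat

theorem integral_shiftDensity_mul {d : ℕ} (h k : Matrix (Fin d) (Fin d) ℝ) :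
    ∫ W, shiftDensity h W * shiftDensity k W ∂stdGaussianMatrix d = Real.exp (frobInner h k) := by
  simp_rw [shiftDensity_eq_prod, ← Finset.prod_mul_distrib]
  have h1 := integral_fintype_prod_eq_prod (𝕜 := ℝ) (μ := fun _ : Fin d =>
      Measure.pi fun _ : Fin d => gaussianReal 0 1)
      (fun a w => ∏ b, Real.exp (h a b * w b - h a b * h a b / 2) *
        Real.exp (k a b * w b - k a b * k a b / 2))
  refine h1.trans ?_
  simp only [frobInner, Real.exp_sum]
  refine Finset.prod_congr rfl fun a _ => ?_
  have h2 := integral_fintype_prod_eq_prod (𝕜 := ℝ) (μ := fun _ : Fin d => gaussianReal 0 1)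
      (fun b x => Real.exp (h a b * x - h a b * h a b / 2) *
        Real.exp (k a b * x - k a b * k a b / 2))
  refine h2.trans ?_
  exact Finset.prod_congr rfl fun b _ => integral_exp_mul_exp_gaussianReal _ _

theorem integrable_shiftDensity_mul {d : ℕ} (h k : Matrix (Fin d) (Fin d) ℝ) :
    Integrable (fun W => shiftDensity h W * shiftDensity k W) (stdGaussianMatrix d) := by
  -- The integral of a non-integrable function is 0 by convention, whereas the value just computed
  -- is positive.
  by_contra hc
  have := integral_shiftDensity_mul h k
  rw [integral_undef hc] at this
  exact (Real.exp_pos _).ne this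

/-- The law of the randomness attached to one edge. -/
def edgeLaw (d : ℕ) (p : unitInterval) : Measure (Bool × Matrix (Fin d) (Fin d) ℝ) :=
  (bernoulliMeasure true false p).prod (stdGaussianMatrix d)

instance isProbabilityMeasure_edgeLaw (d : ℕ) (p : unitInterval) :
    IsProbabilityMeasure (edgeLaw d p) := by
  unfold edgeLaw
  infer_instance

/-- Translation of the noise matrix of an edge, if the edge is present. -/
def edgeShift {d : ℕ} (h : Matrix (Fin d) (Fin d) ℝ) (x : Bool × Matrix (Fin d) (Fin d) ℝ) :
    Bool × Matrix (Fin d) (Fin d) ℝ :=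
  (x.1, if x.1 then x.2 + h else x.2)

/-- The likelihood ratio of `edgeShift`. -/
def edgeDensity {d : ℕ} (h : Matrix (Fin d) (Fin d) ℝ) (x : Bool × Matrix (Fin d) (Fin d) ℝ) : ℝ :=
  if x.1 then shiftDensity h x.2 else 1

theorem measurable_matrix_add_const {d : ℕ} (h : Matrix (Fin d) (Fin d) ℝ) :
    Measurable fun W : Matrix (Fin d) (Fin d) ℝ => W + h :=
  measurable_matrix fun a b => (measurable_entry a b).add_const (h a b)

theorem measurable_edgeShift {d : ℕ} (h : Matrix (Fin d) (Fin d) ℝ) :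
    Measurable (edgeShift h) :=
  measurable_fst.prodMk (Measurable.ite (measurable_fst (measurableSet_singleton true))
    ((measurable_matrix_add_const h).comp measurable_snd) measurable_snd)

theorem measurable_edgeDensity {d : ℕ} (h : Matrix (Fin d) (Fin d) ℝ) :
    Measurable (edgeDensity h) :=
  Measurable.ite (measurable_fst (measurableSet_singleton true))
    ((measurable_shiftDensity h).comp measurable_snd) measurable_const

theorem edgeDensity_pos {d : ℕ} (h : Matrix (Fin d) (Fin d) ℝ)
    (x : Bool × Matrix (Fin d) (Fin d) ℝ) : 0 < edgeDensity h x := by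
  unfold edgeDensity shiftDensity
  split_ifs <;> positivity

/-- Conditionally on the indicator, an absent edge is not moved, and a present one undergoes a
Gaussian translation. -/
theorem edgeLaw_map_edgeShift {d : ℕ} (p : unitInterval) (h : Matrix (Fin d) (Fin d) ℝ) :
    (edgeLaw d p).map (edgeShift h) =
      (edgeLaw d p).withDensity fun x => ENNReal.ofReal (edgeDensity h x) := by
  refine Measure.ext_of_lintegral _ fun f hf => ?_
  rw [lintegral_map hf (measurable_edgeShift h),
    lintegral_withDensity_eq_lintegral_mul _ (measurable_edgeDensity h).ennreal_ofReal hf]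
  unfold edgeLaw
  rw [lintegral_prod (fun x => f (edgeShift h x)) (hf.comp (measurable_edgeShift h)).aemeasurable,
    lintegral_prod _ ((measurable_edgeDensity h).ennreal_ofReal.mul hf).aemeasurable]
  refine lintegral_congr fun A => ?_
  cases A with
  | false => simp [edgeShift, edgeDensity]
  | true =>
    have hft : Measurable fun W => f (true, W) := hf.comp measurable_prodMk_left
    have h1 := lintegral_map (μ := stdGaussianMatrix d) hft (measurable_matrix_add_const h)
    rw [stdGaussianMatrix_map_add, lintegral_withDensity_eq_lintegral_mul _
      (measurable_shiftDensity h).ennreal_ofReal hft] at h1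
    simpa [edgeShift, edgeDensity] using h1.symm

theorem integrable_edgeDensity_mul {d : ℕ} (p : unitInterval) (h k : Matrix (Fin d) (Fin d) ℝ) :
    Integrable (fun x => edgeDensity h x * edgeDensity k x) (edgeLaw d p) := by
  unfold edgeLaw
  refine (integrable_prod_iff
    ((measurable_edgeDensity h).mul (measurable_edgeDensity k)).aestronglyMeasurable).2 ⟨Filter.Eventually.of_forall fun A => ?_, integrable_bernoulliMeasure _ _ _ _⟩
  cases A with
  | false => simp [edgeDensity]
  | true => simpa [edgeDensity] using integrable_shiftDensity_mul h k

theorem integral_edgeDensity_mul {d : ℕ} (p : unitInterval) (h k : Matrix (Fin d) (Fin d) ℝ) :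
    ∫ x, edgeDensity h x * edgeDensity k x ∂edgeLaw d p =
      1 + p * (Real.exp (frobInner h k) - 1) := by
  have hi := integrable_edgeDensity_mul p h k
  unfold edgeLaw at hi ⊢
  rw [integral_prod _ hi, integral_bernoulliMeasure]
  simp only [edgeDensity, if_true, integral_shiftDensity_mul, smul_eq_mul]
  simp
  ring

/-- Translation of the noise matrices of the edges that are present. -/
def noiseShift {n d : ℕ} (h : Pairs n → Matrix (Fin d) (Fin d) ℝ) (ω : Noise n d) : Noise n d :=
  fun e => edgeShift (h e) (ω e)

/-- The likelihood ratio of `noiseShift`. -/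
def noiseDensity {n d : ℕ} (h : Pairs n → Matrix (Fin d) (Fin d) ℝ) (ω : Noise n d) : ℝ :=
  ∏ e, edgeDensity (h e) (ω e)

theorem measurable_noiseDensity {n d : ℕ} (h : Pairs n → Matrix (Fin d) (Fin d) ℝ) :
    Measurable (noiseDensity h) :=
  Finset.measurable_prod _ fun e _ => (measurable_edgeDensity (h e)).comp (measurable_pi_apply e)

theorem measurable_noiseShift {n d : ℕ} (h : Pairs n → Matrix (Fin d) (Fin d) ℝ) :
    Measurable (noiseShift h) :=
  measurable_pi_lambda _ fun e => (measurable_edgeShift (h e)).comp (measurable_pi_apply e)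

theorem noiseDensity_nonneg {n d : ℕ} (h : Pairs n → Matrix (Fin d) (Fin d) ℝ) (ω : Noise n d) :
    0 ≤ noiseDensity h ω :=
  Finset.prod_nonneg fun _ _ => (edgeDensity_pos _ _).le

/-- This trades a moved parameter for a weight, so that two parameters are compared under one noise
law. -/
theorem integral_comp_noiseShift {n d : ℕ} (p : unitInterval)
    (h : Pairs n → Matrix (Fin d) (Fin d) ℝ) {f : Noise n d → ℝ} (hf : Measurable f) :
    ∫ ω, f (noiseShift h ω) ∂noiseLaw n d p =
      ∫ ω, noiseDensity h ω * f ω ∂noiseLaw n d p := by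
  have hmap : (noiseLaw n d p).map (noiseShift h) =
      (noiseLaw n d p).withDensity fun ω => ENNReal.ofReal (noiseDensity h ω) :=
    pi_map_eq_withDensity (fun _ : Pairs n => edgeLaw d p) (fun e => measurable_edgeShift (h e))
      (fun e => measurable_edgeDensity (h e)) (fun e x => (edgeDensity_pos (h e) x).le)
      fun e => edgeLaw_map_edgeShift p (h e)
  rw [← integral_map (measurable_noiseShift h).aemeasurable hf.aestronglyMeasurable, hmap,
    integral_withDensity_eq_integral_toReal_smul (measurable_noiseDensity h).ennreal_ofReal
      (by simp)]
  simp [ENNReal.toReal_ofReal (noiseDensity_nonneg h _)]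

theorem integrable_noiseDensity_mul {n d : ℕ} (p : unitInterval)
    (h k : Pairs n → Matrix (Fin d) (Fin d) ℝ) :
    Integrable (fun ω => noiseDensity h ω * noiseDensity k ω) (noiseLaw n d p) := by
  simp only [noiseDensity, ← Finset.prod_mul_distrib]
  exact Integrable.fintype_prod (μ := fun _ : Pairs n => edgeLaw d p)
    fun e => integrable_edgeDensity_mul p (h e) (k e)

theorem integral_noiseDensity_mul {n d : ℕ} (p : unitInterval)
    (h k : Pairs n → Matrix (Fin d) (Fin d) ℝ) :
    ∫ ω, noiseDensity h ω * noiseDensity k ω ∂noiseLaw n d p =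
      ∏ e, (1 + p * (Real.exp (frobInner (h e) (k e)) - 1)) := by
  simp only [noiseDensity, ← Finset.prod_mul_distrib, ← integral_edgeDensity_mul]
  exact integral_fintype_prod_eq_prod (𝕜 := ℝ) (μ := fun _ : Pairs n => edgeLaw d p)
    fun e x => edgeDensity (h e) x * edgeDensity (k e) x

theorem noiseDensity_zero {n d : ℕ} (ω : Noise n d) : noiseDensity 0 ω = 1 := by
  simp [noiseDensity, edgeDensity, shiftDensity, frobInner]

theorem integrable_noiseDensity {n d : ℕ} (p : unitInterval)
    (h : Pairs n → Matrix (Fin d) (Fin d) ℝ) :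
    Integrable (noiseDensity h) (noiseLaw n d p) := by
  simpa [noiseDensity_zero] using integrable_noiseDensity_mul p h 0

theorem integral_noiseDensity {n d : ℕ} (p : unitInterval)
    (h : Pairs n → Matrix (Fin d) (Fin d) ℝ) :
    ∫ ω, noiseDensity h ω ∂noiseLaw n d p = 1 := by
  simpa [noiseDensity_zero, frobInner] using integral_noiseDensity_mul p h 0

/-! ### Frobenius geometry and the compact group SO(d) -/

theorem coe_transpose_mul_coe {d : ℕ} (A : SO d) :
    (A : Matrix (Fin d) (Fin d) ℝ).transpose * (A : Matrix (Fin d) (Fin d) ℝ) = 1 :=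
  A.2.1.1

theorem frobInner_eq_trace {d : ℕ} (X Y : Matrix (Fin d) (Fin d) ℝ) :
    frobInner X Y = (X.transpose * Y).trace := by
  simp only [frobInner, Matrix.trace, Matrix.diag, Matrix.mul_apply, Matrix.transpose_apply]
  exact Finset.sum_comm

theorem frobInner_mul_mul_transpose {d : ℕ} (U V : SO d) (X Y : Matrix (Fin d) (Fin d) ℝ) :
    frobInner ((U : Matrix (Fin d) (Fin d) ℝ) * X * (V : Matrix (Fin d) (Fin d) ℝ).transpose)
      ((U : Matrix (Fin d) (Fin d) ℝ) * Y * (V : Matrix (Fin d) (Fin d) ℝ).transpose) =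
      frobInner X Y := by
  rw [frobInner_eq_trace, frobInner_eq_trace]
  simp only [Matrix.transpose_mul, Matrix.transpose_transpose]
  calc _ = ((V : Matrix (Fin d) (Fin d) ℝ) * (X.transpose *
        ((U : Matrix (Fin d) (Fin d) ℝ).transpose * (U : Matrix (Fin d) (Fin d) ℝ)) * Y *
          (V : Matrix (Fin d) (Fin d) ℝ).transpose)).trace := by simp only [mul_assoc]
    _ = _ := by
      rw [Matrix.trace_mul_comm, mul_assoc (X.transpose * _ * Y), coe_transpose_mul_coe,
        coe_transpose_mul_coe, mul_one, mul_one]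

theorem frobSq_eq_frobInner {d : ℕ} (X : Matrix (Fin d) (Fin d) ℝ) :
    frobSq X = frobInner X X := by
  simp only [frobSq, frobInner, sq]

theorem frobInner_self_nonneg {d : ℕ} (X : Matrix (Fin d) (Fin d) ℝ) : 0 ≤ frobInner X X :=
  Finset.sum_nonneg fun _ _ => Finset.sum_nonneg fun _ _ => mul_self_nonneg _

theorem frobInner_comm {d : ℕ} (X Y : Matrix (Fin d) (Fin d) ℝ) :
    frobInner X Y = frobInner Y X := by
  simp only [frobInner, mul_comm]

theorem frobInner_add_left {d : ℕ} (X Y Z : Matrix (Fin d) (Fin d) ℝ) :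
    frobInner (X + Y) Z = frobInner X Z + frobInner Y Z := by
  simp only [frobInner, Matrix.add_apply, add_mul, Finset.sum_add_distrib]

theorem frobInner_sub_left {d : ℕ} (X Y Z : Matrix (Fin d) (Fin d) ℝ) :
    frobInner (X - Y) Z = frobInner X Z - frobInner Y Z := by
  simp only [frobInner, Matrix.sub_apply, sub_mul, Finset.sum_sub_distrib]

theorem frobInner_smul_left {d : ℕ} (c : ℝ) (X Y : Matrix (Fin d) (Fin d) ℝ) :
    frobInner (c • X) Y = c * frobInner X Y := by
  simp only [frobInner, Matrix.smul_apply, smul_eq_mul, Finset.mul_sum, mul_assoc]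

theorem frobInner_add_right {d : ℕ} (X Y Z : Matrix (Fin d) (Fin d) ℝ) :
    frobInner X (Y + Z) = frobInner X Y + frobInner X Z := by
  simp only [frobInner_comm X, frobInner_add_left]

theorem frobInner_sub_right {d : ℕ} (X Y Z : Matrix (Fin d) (Fin d) ℝ) :
    frobInner X (Y - Z) = frobInner X Y - frobInner X Z := by
  simp only [frobInner_comm X, frobInner_sub_left]

theorem frobInner_smul_right {d : ℕ} (c : ℝ) (X Y : Matrix (Fin d) (Fin d) ℝ) :
    frobInner X (c • Y) = c * frobInner X Y := by
  simp only [frobInner_comm X, frobInner_smul_left]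

theorem frobInner_sum_left {ι : Type*} (s : Finset ι) {d : ℕ}
    (X : ι → Matrix (Fin d) (Fin d) ℝ) (Y : Matrix (Fin d) (Fin d) ℝ) :
    frobInner (∑ i ∈ s, X i) Y = ∑ i ∈ s, frobInner (X i) Y := by
  classical
  induction s using Finset.induction_on with
  | empty => simp [frobInner]
  | insert i s hi ih => rw [Finset.sum_insert hi, Finset.sum_insert hi, frobInner_add_left, ih]

theorem frobInner_sum_right {ι : Type*} (s : Finset ι) {d : ℕ}
    (X : Matrix (Fin d) (Fin d) ℝ) (Y : ι → Matrix (Fin d) (Fin d) ℝ) :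
    frobInner X (∑ i ∈ s, Y i) = ∑ i ∈ s, frobInner X (Y i) := by
  simp only [frobInner_comm X, frobInner_sum_left]

theorem frobInner_one_one (d : ℕ) : frobInner (1 : Matrix (Fin d) (Fin d) ℝ) 1 = d := by
  simp [frobInner_eq_trace]

theorem frobInner_coe_coe {d : ℕ} (U : SO d) :
    frobInner (U : Matrix (Fin d) (Fin d) ℝ) U = d := by
  rw [frobInner_eq_trace, coe_transpose_mul_coe, Matrix.trace_one, Fintype.card_fin]

theorem abs_apply_le_one {d : ℕ} (U : SO d) (a b : Fin d) :
    |(U : Matrix (Fin d) (Fin d) ℝ) a b| ≤ 1 := by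
  have h := congrFun (congrFun (coe_transpose_mul_coe U) b) b
  rw [Matrix.mul_apply, Matrix.one_apply_eq] at h
  rw [← sq_le_one_iff_abs_le_one, ← h]
  simp only [Matrix.transpose_apply, ← sq]
  exact Finset.single_le_sum (f := fun j => (U : Matrix (Fin d) (Fin d) ℝ) j b ^ 2)
    (fun _ _ => sq_nonneg _) (Finset.mem_univ a)

/-- The rotations form a closed subset of the cube of matrices with entries in [-1, 1]. Compactness
makes Haar measure a usable prior. -/
instance compactSpace_SO (d : ℕ) : CompactSpace (SO d) := by
  suffices h : IsCompact
      (Matrix.specialOrthogonalGroup (Fin d) ℝ : Set (Matrix (Fin d) (Fin d) ℝ)) from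
    isCompact_iff_compactSpace.1 h
  have hK : IsCompact {M : Matrix (Fin d) (Fin d) ℝ | ∀ a ∈ (Set.univ : Set (Fin d)),
      ∀ b ∈ (Set.univ : Set (Fin d)), M a b ∈ Set.Icc (-1 : ℝ) 1} :=
    isCompact_univ_pi fun _ => isCompact_univ_pi fun _ => isCompact_Icc
  refine hK.of_isClosed_subset ?_ fun M hM a _ b _ => abs_le.1 (abs_apply_le_one ⟨M, hM⟩ a b)
  have hset : (Matrix.specialOrthogonalGroup (Fin d) ℝ : Set (Matrix (Fin d) (Fin d) ℝ)) =
      {M | M * M.transpose = 1} ∩ {M | M.det = 1} := by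
    ext M
    exact (Matrix.mem_specialOrthogonalGroup_iff).trans
      (and_congr_left fun _ => Matrix.mem_orthogonalGroup_iff (Fin d) ℝ)
  rw [hset]
  exact (isClosed_eq (by fun_prop) continuous_const).inter
    (isClosed_eq (by fun_prop) continuous_const)

instance isTopologicalGroup_SO (d : ℕ) : IsTopologicalGroup (SO d) where
  continuous_inv := Continuous.subtype_mk (continuous_subtype_val.matrix_transpose) _

instance secondCountableTopology_matrix (d : ℕ) :
    SecondCountableTopology (Matrix (Fin d) (Fin d) ℝ) :=
  inferInstanceAs (SecondCountableTopology (Fin d → Fin d → ℝ))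

instance borelSpace_matrix (d : ℕ) : BorelSpace (Matrix (Fin d) (Fin d) ℝ) :=
  inferInstanceAs (BorelSpace (Fin d → Fin d → ℝ))

instance borelSpace_SO (d : ℕ) : BorelSpace (SO d) :=
  Subtype.borelSpace _

instance secondCountableTopology_SO (d : ℕ) : SecondCountableTopology (SO d) :=
  TopologicalSpace.Subtype.secondCountableTopology _

/-- `Measure.haarMeasure` is left-invariant, while the perturbations multiply on the right;
inversion exchanges the two. Normalizing on the whole compact group gives mass one. -/
theorem exists_isProbabilityMeasure_isMulRightInvariant (G : Type*) [Group G] [TopologicalSpace G]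
    [IsTopologicalGroup G] [CompactSpace G] [MeasurableSpace G] [BorelSpace G] :
    ∃ π : Measure G, IsProbabilityMeasure π ∧ π.IsMulRightInvariant := by
  let μ : Measure G := Measure.haarMeasure ⊤
  have hμ : μ Set.univ = 1 := by
    simpa using Measure.haarMeasure_self (K₀ := (⊤ : TopologicalSpace.PositiveCompacts G))
  refine ⟨μ.inv, ⟨?_⟩, inferInstance⟩
  rw [Measure.inv_apply, Set.inv_univ, hμ]

/-! ### Plane rotations and their generators -/

/-- The infinitesimal rotation in the plane of the coordinates `a` and `b`. -/
def skew {d : ℕ} (k : Fin d × Fin d) : Matrix (Fin d) (Fin d) ℝ :=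
  Matrix.single k.1 k.2 1 - Matrix.single k.2 k.1 1

theorem skew_transpose {d : ℕ} (k : Fin d × Fin d) : (skew k).transpose = -skew k := by
  simp [skew]

theorem skew_mul_skew {d : ℕ} (k : Fin d × Fin d) : skew k * skew k =
    if k.1 = k.2 then 0 else -Matrix.single k.1 k.1 1 - Matrix.single k.2 k.2 1 := by
  obtain ⟨a, b⟩ := k
  split_ifs with h
  · simp only at h
    simp [skew, h]
  · simp only at h
    simp [skew, mul_sub, sub_mul, Matrix.single_mul_single_of_ne, h, Ne.symm h]
    abel

/-- Off the diagonal, minus the square of the generator is the projection onto its plane. This cubic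
relation is what makes the Rodrigues formula `givensMatrix` additive in the angle. -/
theorem skew_mul_skew_mul_skew {d : ℕ} (k : Fin d × Fin d) :
    skew k * (skew k * skew k) = -skew k := by
  rw [skew_mul_skew]
  obtain ⟨a, b⟩ := k
  split_ifs with h
  · simp only at h
    simp [skew, h]
  · simp only at h
    simp [skew, mul_sub, sub_mul, Matrix.single_mul_single_of_ne, h, Ne.symm h]

/-- The rotation by the angle `t` in the plane of the coordinates `a` and `b`, as a matrix. -/
def givensMatrix {d : ℕ} (k : Fin d × Fin d) (t : ℝ) : Matrix (Fin d) (Fin d) ℝ :=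
  1 + Real.sin t • skew k + (1 - Real.cos t) • (skew k * skew k)

theorem givensMatrix_zero {d : ℕ} (k : Fin d × Fin d) : givensMatrix k 0 = 1 := by
  simp [givensMatrix]

theorem givensMatrix_add {d : ℕ} (k : Fin d × Fin d) (s t : ℝ) :
    givensMatrix k (s + t) = givensMatrix k s * givensMatrix k t := by
  have h1 := skew_mul_skew_mul_skew k
  have h2 : skew k * skew k * skew k = -skew k := by rw [mul_assoc, h1]
  have h3 : skew k * skew k * (skew k * skew k) = -(skew k * skew k) := by
    rw [← mul_assoc, h2, neg_mul]
  simp only [givensMatrix, add_mul, mul_add, one_mul, mul_one, smul_mul_assoc, mul_smul_comm,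
    h1, h2, h3, Real.sin_add, Real.cos_add]
  module

theorem givensMatrix_transpose {d : ℕ} (k : Fin d × Fin d) (t : ℝ) :
    (givensMatrix k t).transpose = givensMatrix k (-t) := by
  simp [givensMatrix, skew_transpose, Matrix.transpose_mul]

theorem givensMatrix_mul_transpose {d : ℕ} (k : Fin d × Fin d) (t : ℝ) :
    givensMatrix k t * (givensMatrix k t).transpose = 1 := by
  rw [givensMatrix_transpose, ← givensMatrix_add, add_neg_cancel, givensMatrix_zero]

/-- The rotation is the square of its half-angle rotation H, so its determinant is det H · det Hᵀ =
1. -/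
theorem det_givensMatrix {d : ℕ} (k : Fin d × Fin d) (t : ℝ) : (givensMatrix k t).det = 1 := by
  have h := congrArg Matrix.det (givensMatrix_mul_transpose k (t / 2))
  rw [Matrix.det_mul, Matrix.det_transpose, Matrix.det_one, ← Matrix.det_mul,
    ← givensMatrix_add, add_halves] at h
  exact h

/-- The rotation by the angle `t` in the plane of the coordinates `a` and `b`. -/
def givens {d : ℕ} (k : Fin d × Fin d) (t : ℝ) : SO d :=
  ⟨givensMatrix k t, Matrix.mem_specialOrthogonalGroup_iff.2
    ⟨(Matrix.mem_orthogonalGroup_iff (Fin d) ℝ).2 (givensMatrix_mul_transpose k t),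
      det_givensMatrix k t⟩⟩

theorem sum_single_self (d : ℕ) :
    ∑ a : Fin d, Matrix.single a a (1 : ℝ) = 1 := by
  ext i j
  simp [Matrix.sum_apply, Matrix.single_apply, Matrix.one_apply, ite_and]

/-- The sum runs over ordered pairs: diagonal ones vanish and every plane counts twice. This scalar
Casimir element yields the term 16d(d-1)² in the limit of `testMoment`. -/
theorem sum_skew_mul_skew (d : ℕ) :
    ∑ k : Fin d × Fin d, skew k * skew k =
      (-(2 * ((d : ℝ) - 1))) • (1 : Matrix (Fin d) (Fin d) ℝ) := by
  have h : ∀ k : Fin d × Fin d, skew k * skew k =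
      (if k.1 = k.2 then (2 : ℝ) • Matrix.single k.1 k.1 1 else 0) -
        Matrix.single k.1 k.1 1 - Matrix.single k.2 k.2 1 := by
    rintro ⟨a, b⟩
    rw [skew_mul_skew]
    split_ifs with h
    · simp only at h
      subst h
      module
    · simp
  simp_rw [h, Fintype.sum_prod_type]
  simp only [Finset.sum_sub_distrib, Finset.sum_ite_eq, Finset.mem_univ, if_true, sum_single_self,
    Finset.sum_const, Finset.card_univ, Fintype.card_fin, ← Finset.smul_sum]
  simp only [← Nat.cast_smul_eq_nsmul ℝ]
  module

theorem frobInner_single_single {d : ℕ} (a b a' b' : Fin d) :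
    frobInner (Matrix.single a b (1 : ℝ)) (Matrix.single a' b' 1) =
      (if a = a' then 1 else 0) * (if b = b' then 1 else 0) := by
  simp only [frobInner, Matrix.single_apply, ite_and, mul_ite, mul_one, mul_zero,
    Finset.sum_ite_irrel, Finset.sum_ite_eq, Finset.sum_const_zero, Finset.mem_univ,
    if_true]
  split_ifs <;> simp_all

theorem frobInner_skew_skew {d : ℕ} (k l : Fin d × Fin d) :
    frobInner (skew k) (skew l) =
      2 * ((if k.1 = l.1 then 1 else 0) * (if k.2 = l.2 then 1 else 0) -
        (if k.1 = l.2 then 1 else 0) * (if k.2 = l.1 then 1 else 0)) := by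
  simp only [skew, frobInner_sub_left, frobInner_sub_right, frobInner_single_single]
  ring

theorem sum_frobInner_skew_self (d : ℕ) :
    ∑ k : Fin d × Fin d, frobInner (skew k) (skew k) = 2 * (d : ℝ) * ((d : ℝ) - 1) := by
  have h : ∀ k : Fin d × Fin d, frobInner (skew k) (skew k) =
      2 - 2 * if k.1 = k.2 then 1 else 0 := by
    rintro ⟨a, b⟩
    rw [frobInner_skew_skew]
    by_cases h : a = b <;> simp [h]
  simp_rw [h, Fintype.sum_prod_type]
  simp [Finset.sum_sub_distrib]
  ring

/-- For off-diagonal k only l = k and l = `k.swap` contribute, with inner products 2 and -2. -/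
theorem sum_sum_frobInner_skew_sq (d : ℕ) :
    ∑ k : Fin d × Fin d, ∑ l : Fin d × Fin d, frobInner (skew k) (skew l) ^ 2 =
      8 * (d : ℝ) * ((d : ℝ) - 1) := by
  have h : ∀ k l : Fin d × Fin d, frobInner (skew k) (skew l) ^ 2 =
      4 * ((if k = l then 1 else 0) + (if k.swap = l then 1 else 0) -
        2 * if k.1 = k.2 then (if k = l then 1 else 0) else 0) := by
    rintro ⟨a, b⟩ ⟨a', b'⟩
    rw [frobInner_skew_skew]
    simp only [Prod.swap_prod_mk, Prod.mk.injEq]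
    by_cases h1 : a = a' <;> by_cases h2 : b = b' <;> by_cases h3 : a = b <;>
      by_cases h4 : a' = b' <;> by_cases h5 : a = b' <;> by_cases h6 : b = a' <;> simp_all <;>
      norm_num
  simp_rw [h]
  simp only [← Finset.mul_sum, Finset.sum_sub_distrib, Finset.sum_add_distrib, Finset.sum_ite_eq,
    Finset.mem_univ, if_true, Finset.sum_ite_irrel, Finset.sum_const_zero, Finset.sum_const,
    Finset.card_univ, Fintype.card_prod, Fintype.card_fin, Fintype.sum_prod_type]
  simp
  ring

/-! ### Limits of the moments as the step tends to zero -/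

open Filter Topology

/-- The product rule at the value 1; each factor tends to 1 because its quotient converges and u
tends to 0. -/
theorem tendsto_prod_sub_one_div {ι α : Type*} {l : Filter α} (s : Finset ι) {f : ι → α → ℝ}
    {u : α → ℝ} {a : ι → ℝ} (hu : Tendsto u l (𝓝 0)) (hu0 : ∀ᶠ x in l, u x ≠ 0)
    (h : ∀ i ∈ s, Tendsto (fun x => (f i x - 1) / u x) l (𝓝 (a i))) :
    Tendsto (fun x => (∏ i ∈ s, f i x - 1) / u x) l (𝓝 (∑ i ∈ s, a i)) := by
  classical
  induction s using Finset.induction_on with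
  | empty => simpa using tendsto_const_nhds
  | insert i s hi ih =>
    have hs := ih fun j hj => h j (Finset.mem_insert_of_mem hj)
    have h1 := h i (Finset.mem_insert_self i s)
    have hP : Tendsto (fun x => ∏ j ∈ s, f j x) l (𝓝 1) := by
      have h2 := (hs.mul hu).add_const 1
      simp only [mul_zero, zero_add] at h2
      refine h2.congr' ?_
      filter_upwards [hu0] with x hx
      field_simp
      ring
    have h3 := (h1.mul hP).add hs
    rw [Finset.sum_insert hi]
    rw [mul_one] at h3
    refine h3.congr fun x => ?_
    rw [Finset.prod_insert hi]
    ring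

theorem tendsto_exp_sub_one_div {α : Type*} {l : Filter α} {c u : α → ℝ} {a : ℝ}
    (hu : Tendsto u l (𝓝 0)) (hu0 : ∀ᶠ x in l, u x ≠ 0)
    (h : Tendsto (fun x => c x / u x) l (𝓝 a)) :
    Tendsto (fun x => (Real.exp (c x) - 1) / u x) l (𝓝 a) := by
  have hc : Tendsto c l (𝓝 0) := by
    have h2 := h.mul hu
    rw [mul_zero] at h2
    refine h2.congr' ?_
    filter_upwards [hu0] with x hx
    field_simp
  -- `dslope` extends the difference quotient continuously through 0, so points with c x = 0 need no
  -- separate treatment.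
  have hd : Tendsto (dslope Real.exp 0) (𝓝 0) (𝓝 1) := by
    have h1 := continuousAt_dslope_same.2 (Real.differentiableAt_exp (x := 0))
    simpa [ContinuousAt, dslope_same] using h1
  have h3 := h.mul (hd.comp hc)
  rw [mul_one] at h3
  refine h3.congr fun x => ?_
  have h4 := sub_smul_dslope Real.exp 0 (c x)
  simp only [sub_zero, smul_eq_mul, Real.exp_zero] at h4
  rw [← h4, Function.comp_apply]
  ring

theorem tendsto_inv_smul_givensMatrix_sub_one {d : ℕ} (k : Fin d × Fin d) (α : ℝ) :
    Tendsto (fun t : ℝ => t⁻¹ • (givensMatrix k (α * t) - 1)) (𝓝[≠] 0) (𝓝 (α • skew k)) := by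
  have hα : HasDerivAt (fun t : ℝ => α * t) α 0 := by
    simpa using (hasDerivAt_id (0 : ℝ)).const_mul α
  have hs : HasDerivAt (fun t : ℝ => Real.sin (α * t)) α 0 := by
    simpa using hα.sin
  have hc : HasDerivAt (fun t : ℝ => 1 - Real.cos (α * t)) 0 0 := by
    simpa using hα.cos.const_sub 1
  have hs' := hs.tendsto_slope_zero
  have hc' := hc.tendsto_slope_zero
  have h := (hs'.smul_const (skew k)).add (hc'.smul_const (skew k * skew k))
  simp only [zero_smul, add_zero, zero_add, mul_zero, Real.sin_zero, Real.cos_zero, sub_self,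
    sub_zero, smul_eq_mul] at h
  refine h.congr fun t => ?_
  simp only [givensMatrix, mul_smul, smul_add, smul_sub]
  module

theorem continuous_givensMatrix {d : ℕ} (k : Fin d × Fin d) : Continuous (givensMatrix k) := by
  unfold givensMatrix
  fun_prop

theorem tendsto_frobInner {α : Type*} {l : Filter α} {d : ℕ}
    {X Y : α → Matrix (Fin d) (Fin d) ℝ} {A B : Matrix (Fin d) (Fin d) ℝ}
    (hX : Tendsto X l (𝓝 A)) (hY : Tendsto Y l (𝓝 B)) :
    Tendsto (fun x => frobInner (X x) (Y x)) l (𝓝 (frobInner A B)) := by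
  have h : Continuous fun q : Matrix (Fin d) (Fin d) ℝ × Matrix (Fin d) (Fin d) ℝ =>
      frobInner q.1 q.2 := by
    unfold frobInner
    fun_prop
  have h1 := hX.prodMk_nhds hY
  have h2 := (h.tendsto (A, B)).comp h1
  exact h2

/-- The mean of the product of the likelihood ratios of the shifts along two rotations. -/
def ratioMoment {d : ℕ} {ε : Type*} [Fintype ε] (σ p : ℝ) (α : ε → ℝ) (k l : Fin d × Fin d)
    (t : ℝ) : ℝ :=
  ∏ e, (1 + p * (Real.exp (frobInner (givensMatrix k (α e * t) - 1)
    (givensMatrix l (α e * t) - 1) / σ ^ 2) - 1))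

theorem tendsto_sq_punctured : Tendsto (fun t : ℝ => t ^ 2) (𝓝[≠] 0) (𝓝 0) := by
  have h : Tendsto (fun t : ℝ => t ^ 2) (𝓝 0) (𝓝 (0 ^ 2)) := (continuous_pow 2).tendsto 0
  rw [zero_pow two_ne_zero] at h
  exact h.mono_left nhdsWithin_le_nhds

theorem eventually_sq_ne_zero : ∀ᶠ t : ℝ in 𝓝[≠] 0, t ^ 2 ≠ 0 := by
  filter_upwards [self_mem_nhdsWithin] with t ht
  exact pow_ne_zero 2 ht

/-- The limit is the Fisher information between the directions k and l: an edge contributes its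
squared relative speed, weighted by p/σ². -/
theorem tendsto_ratioMoment {d : ℕ} {ε : Type*} [Fintype ε] (σ p : ℝ) (α : ε → ℝ)
    (k l : Fin d × Fin d) :
    Tendsto (fun t => (ratioMoment σ p α k l t - 1) / t ^ 2) (𝓝[≠] 0)
      (𝓝 (p * (∑ e, α e ^ 2) / σ ^ 2 * frobInner (skew k) (skew l))) := by
  have hsum : p * (∑ e, α e ^ 2) / σ ^ 2 * frobInner (skew k) (skew l) =
      ∑ e, p * (frobInner (α e • skew k) (α e • skew l) / σ ^ 2) := by
    simp only [frobInner_smul_left, frobInner_smul_right, Finset.mul_sum, Finset.sum_mul,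
      Finset.sum_div]
    exact Finset.sum_congr rfl fun e _ => by ring
  rw [hsum]
  refine tendsto_prod_sub_one_div _ tendsto_sq_punctured eventually_sq_ne_zero fun e _ => ?_
  have h := tendsto_frobInner (tendsto_inv_smul_givensMatrix_sub_one k (α e))
    (tendsto_inv_smul_givensMatrix_sub_one l (α e))
  have h1 : Tendsto (fun t => frobInner (givensMatrix k (α e * t) - 1)
      (givensMatrix l (α e * t) - 1) / σ ^ 2 / t ^ 2) (𝓝[≠] 0)
      (𝓝 (frobInner (α e • skew k) (α e • skew l) / σ ^ 2)) := by
    refine (h.div_const (σ ^ 2)).congr fun t => ?_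
    rw [frobInner_smul_left, frobInner_smul_right]
    ring
  have h2 := (tendsto_exp_sub_one_div tendsto_sq_punctured eventually_sq_ne_zero h1).const_mul p
  refine h2.congr fun t => ?_
  ring

/-- The mean squared norm of the test matrix of the van Trees argument with step `t`. -/
def testMoment (d : ℕ) {ε : Type*} [Fintype ε] (σ p : ℝ) (α : ε → ℝ) (t : ℝ) : ℝ :=
  ∑ k : Fin d × Fin d, ∑ l : Fin d × Fin d,
    ((ratioMoment σ p α k l t - 1) / t ^ 2 *
      frobInner (skew k * givensMatrix k (2 * t)) (skew l * givensMatrix l (2 * t)) +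
    frobInner (skew k * t⁻¹ • (givensMatrix k (2 * t) - 1))
      (skew l * t⁻¹ • (givensMatrix l (2 * t) - 1)))

theorem tendsto_skew_mul_givensMatrix {d : ℕ} (k : Fin d × Fin d) :
    Tendsto (fun t : ℝ => skew k * givensMatrix k (2 * t)) (𝓝[≠] 0) (𝓝 (skew k)) := by
  have h : Continuous fun t : ℝ => skew k * givensMatrix k (2 * t) :=
    continuous_const.mul ((continuous_givensMatrix k).comp (by fun_prop))
  have h0 := h.tendsto 0
  simp only [mul_zero, givensMatrix_zero, mul_one] at h0
  exact h0.mono_left nhdsWithin_le_nhds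

/-- The first term is the Fisher information paired with the Gram matrix of the generators. The
second comes from the variation of each tangent vector along its own rotation, and is the squared
norm of twice the Casimir sum. -/
theorem tendsto_testMoment (d : ℕ) {ε : Type*} [Fintype ε] (σ p : ℝ) (α : ε → ℝ) :
    Tendsto (testMoment d σ p α) (𝓝[≠] 0)
      (𝓝 (p * (∑ e, α e ^ 2) / σ ^ 2 * (8 * d * (d - 1)) + 16 * d * (d - 1) ^ 2)) := by
  have hlim : p * (∑ e, α e ^ 2) / σ ^ 2 * (8 * (d : ℝ) * (d - 1)) + 16 * d * (d - 1) ^ 2 =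
      ∑ k : Fin d × Fin d, ∑ l : Fin d × Fin d,
        (p * (∑ e, α e ^ 2) / σ ^ 2 * frobInner (skew k) (skew l) * frobInner (skew k) (skew l) +
          frobInner (skew k * (2 : ℝ) • skew k) (skew l * (2 : ℝ) • skew l)) := by
    have h : ∑ k : Fin d × Fin d, ∑ l : Fin d × Fin d,
        frobInner (skew k * (2 : ℝ) • skew k) (skew l * (2 : ℝ) • skew l) =
          16 * (d : ℝ) * (d - 1) ^ 2 := by
      simp only [← frobInner_sum_right]
      rw [← frobInner_sum_left]
      simp only [mul_smul_comm, ← Finset.smul_sum, sum_skew_mul_skew, frobInner_smul_left,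
        frobInner_smul_right, frobInner_one_one]
      ring
    simp only [Finset.sum_add_distrib, h]
    simp only [mul_assoc _ (frobInner _ _) (frobInner _ _), ← sq, ← Finset.mul_sum,
      sum_sum_frobInner_skew_sq]
  rw [hlim]
  refine tendsto_finsetSum _ fun k _ => tendsto_finsetSum _ fun l _ => ?_
  refine ((tendsto_ratioMoment σ p α k l).mul (tendsto_frobInner
    (tendsto_skew_mul_givensMatrix k) (tendsto_skew_mul_givensMatrix l))).add
      (tendsto_frobInner ?_ ?_)
  · exact tendsto_const_nhds.mul (tendsto_inv_smul_givensMatrix_sub_one k 2)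
  · exact tendsto_const_nhds.mul (tendsto_inv_smul_givensMatrix_sub_one l 2)

/-- The mean inner product of the error with the test matrix of the van Trees argument with
step `t`. -/
def testMean (d : ℕ) (t : ℝ) : ℝ :=
  ∑ k : Fin d × Fin d, frobInner (t⁻¹ • (givensMatrix k (2 * t) - 1))
    (skew k * givensMatrix k (2 * t))

theorem tendsto_testMean (d : ℕ) :
    Tendsto (testMean d) (𝓝[≠] 0) (𝓝 (4 * d * (d - 1))) := by
  have hlim : 4 * (d : ℝ) * (d - 1) =
      ∑ k : Fin d × Fin d, frobInner ((2 : ℝ) • skew k) (skew k) := by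
    simp only [frobInner_smul_left, ← Finset.mul_sum, sum_frobInner_skew_self]
    ring
  rw [hlim]
  exact tendsto_finsetSum _ fun k _ => tendsto_frobInner
    (tendsto_inv_smul_givensMatrix_sub_one k 2) (tendsto_skew_mul_givensMatrix k)

/-! ### Rotating two vertices in opposite directions -/

/-- The speeds at which two vertices are rotated in opposite directions. -/
def speed {n : ℕ} (i j m : Fin n) : ℝ := (if m = i then 1 else 0) - (if m = j then 1 else 0)

theorem sum_pairs_of_symm {n : ℕ} (f : Fin n → Fin n → ℝ) (hf : ∀ a b, f a b = f b a)
    (hf0 : ∀ a, f a a = 0) :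
    2 * ∑ e : Pairs n, f e.1.1 e.1.2 = ∑ a, ∑ b, f a b := by
  have h1 : ∑ e : Pairs n, f e.1.1 e.1.2 = ∑ a, ∑ b, if a < b then f a b else 0 := by
    rw [← Fintype.sum_prod_type' (fun a b => if a < b then f a b else 0), ← Finset.sum_filter]
    exact (Finset.sum_subtype _ (by simp) fun x : Fin n × Fin n => f x.1 x.2).symm
  have h2 : ∑ a, ∑ b, (if a < b then f a b else 0) = ∑ a, ∑ b, if b < a then f a b else 0 := by
    rw [Finset.sum_comm]
    simp only [hf]
  rw [two_mul, h1]
  nth_rewrite 2 [h2]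
  simp only [← Finset.sum_add_distrib]
  refine Finset.sum_congr rfl fun a _ => Finset.sum_congr rfl fun b _ => ?_
  rcases lt_trichotomy a b with h | h | h
  · simp [h, h.not_gt]
  · simp [h, hf0]
  · simp [h, h.not_gt]

/-- Over all ordered pairs the sum is 2n∑s² - 2(∑s)², where ∑s = 0 and ∑s² = 2; every edge is then
counted twice. -/
theorem sum_speed_sub_speed_sq {n : ℕ} {i j : Fin n} (hij : i ≠ j) :
    ∑ e : Pairs n, (speed i j e.1.1 - speed i j e.1.2) ^ 2 = 2 * n := by
  have h := sum_pairs_of_symm (fun a b => (speed i j a - speed i j b) ^ 2)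
    (fun a b => by ring) (fun a => by ring)
  have h1 : ∑ m, speed i j m = 0 := by simp [speed, Finset.sum_sub_distrib]
  have h2 : ∑ m, speed i j m ^ 2 = 2 := by
    have : ∀ m, speed i j m ^ 2 = (if m = i then 1 else 0) + (if m = j then 1 else 0) := by
      intro m
      unfold speed
      split_ifs with h3 h4 <;> simp_all
    simp only [this, Finset.sum_add_distrib, Finset.sum_ite_eq', Finset.mem_univ, if_true]
    norm_num
  have h3 : ∑ a, ∑ b, (speed i j a - speed i j b) ^ 2 = 2 * (2 * n) := by
    simp only [sub_sq, Finset.sum_add_distrib, Finset.sum_sub_distrib, ← Finset.mul_sum, h1, h2]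
    simp [h2, ← Finset.mul_sum]
    ring
  rw [h3] at h
  linarith

/-- The matrix `Zᵢ X Zⱼᵀ`. -/
def frame {n d : ℕ} (Z : Fin n → SO d) (i j : Fin n) (X : Matrix (Fin d) (Fin d) ℝ) :
    Matrix (Fin d) (Fin d) ℝ :=
  (Z i : Matrix (Fin d) (Fin d) ℝ) * X * (Z j : Matrix (Fin d) (Fin d) ℝ).transpose

section Frame

variable {n d : ℕ} (Z : Fin n → SO d) (i j : Fin n)

theorem frame_one : frame Z i j 1 =
    (Z i : Matrix (Fin d) (Fin d) ℝ) * (Z j : Matrix (Fin d) (Fin d) ℝ).transpose := by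
  rw [frame, mul_one]

theorem frame_sub (X Y : Matrix (Fin d) (Fin d) ℝ) :
    frame Z i j (X - Y) = frame Z i j X - frame Z i j Y := by
  simp only [frame, mul_sub, sub_mul]

theorem frobInner_frame_frame (X Y : Matrix (Fin d) (Fin d) ℝ) :
    frobInner (frame Z i j X) (frame Z i j Y) = frobInner X Y :=
  frobInner_mul_mul_transpose _ _ _ _

theorem abs_frame_one_le (a b : Fin d) : |frame Z i j 1 a b| ≤ 1 := by
  rw [frame_one]
  exact abs_apply_le_one (Z i * (Z j)⁻¹) a b

/-- The rotation of the vertices `i` and `j` by the angles `t` and `-t`. -/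
def rotatePair (k : Fin d × Fin d) (t : ℝ) : Fin n → SO d :=
  fun m => givens k (speed i j m * t)

theorem frame_mul_rotatePair (k : Fin d × Fin d) (t : ℝ) (a b : Fin n)
    (X : Matrix (Fin d) (Fin d) ℝ) :
    frame (Z * rotatePair i j k t) a b X =
      frame Z a b (givensMatrix k (speed i j a * t) * X * givensMatrix k (-(speed i j b * t))) := by
  rw [← givensMatrix_transpose]
  have h : ∀ m, ((Z * rotatePair i j k t) m : Matrix (Fin d) (Fin d) ℝ) =
      (Z m : Matrix (Fin d) (Fin d) ℝ) * givensMatrix k (speed i j m * t) := fun m => rfl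
  simp only [frame, h, Matrix.transpose_mul, mul_assoc]

end Frame

theorem skew_mul_givensMatrix {d : ℕ} (k : Fin d × Fin d) (t : ℝ) :
    skew k * givensMatrix k t = givensMatrix k t * skew k := by
  simp only [givensMatrix, mul_add, add_mul, mul_one, one_mul, mul_smul_comm, smul_mul_assoc,
    mul_assoc]

/-! ### From the quotient loss to pairwise losses -/

section Loss

variable {n d : ℕ} (Zh Z : Fin n → SO d)

theorem frobSq_frame_sub_frame (i j : Fin n) :
    frobSq (frame Zh i j 1 - frame Z i j 1) = 2 * d - 2 * frobInner
      ((Z i : Matrix (Fin d) (Fin d) ℝ).transpose * (Zh i : Matrix (Fin d) (Fin d) ℝ))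
      ((Z j : Matrix (Fin d) (Fin d) ℝ).transpose * (Zh j : Matrix (Fin d) (Fin d) ℝ)) := by
  have h : frobInner (frame Zh i j 1) (frame Z i j 1) = frobInner
      ((Z i : Matrix (Fin d) (Fin d) ℝ).transpose * (Zh i : Matrix (Fin d) (Fin d) ℝ))
      ((Z j : Matrix (Fin d) (Fin d) ℝ).transpose * (Zh j : Matrix (Fin d) (Fin d) ℝ)) := by
    rw [frobInner_eq_trace, frobInner_eq_trace, frame_one, frame_one]
    simp only [Matrix.transpose_mul, Matrix.transpose_transpose]
    rw [mul_assoc, Matrix.trace_mul_comm]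
    simp only [mul_assoc]
  rw [frobSq_eq_frobInner]
  simp only [frobInner_sub_left, frobInner_sub_right, frobInner_frame_frame, frobInner_one_one]
  rw [frobInner_comm (frame Z i j 1), h]
  ring

theorem frobSq_sub_mul (i : Fin n) (B : SO d) :
    frobSq ((Zh i : Matrix (Fin d) (Fin d) ℝ) -
      (Z i : Matrix (Fin d) (Fin d) ℝ) * (B : Matrix (Fin d) (Fin d) ℝ)) =
      2 * d - 2 * frobInner
        ((Z i : Matrix (Fin d) (Fin d) ℝ).transpose * (Zh i : Matrix (Fin d) (Fin d) ℝ)) B := by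
  have h : frobInner (Zh i : Matrix (Fin d) (Fin d) ℝ)
      ((Z i : Matrix (Fin d) (Fin d) ℝ) * (B : Matrix (Fin d) (Fin d) ℝ)) = frobInner
        ((Z i : Matrix (Fin d) (Fin d) ℝ).transpose * (Zh i : Matrix (Fin d) (Fin d) ℝ)) B := by
    rw [frobInner_eq_trace, frobInner_eq_trace]
    simp only [Matrix.transpose_mul, Matrix.transpose_transpose, mul_assoc]
  have h2 : frobInner ((Z i : Matrix (Fin d) (Fin d) ℝ) * (B : Matrix (Fin d) (Fin d) ℝ))
      ((Z i : Matrix (Fin d) (Fin d) ℝ) * (B : Matrix (Fin d) (Fin d) ℝ)) = d :=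
    frobInner_coe_coe (Z i * B)
  rw [frobSq_eq_frobInner]
  simp only [frobInner_sub_left, frobInner_sub_right, frobInner_coe_coe, h2]
  rw [frobInner_comm _ (Zh i : Matrix (Fin d) (Fin d) ℝ), h]
  ring

/-- With N = ∑ ZᵢᵀẐᵢ, the left side is d - |N|²/n² and the loss at B is 2d - 2⟨N, B⟩/n. Since |B|² =
d, they differ by |N/n - B|². -/
theorem pairLoss_le_loss (hn : 1 ≤ n) :
    1 / (2 * (n : ℝ) ^ 2) * ∑ i, ∑ j, frobSq (frame Zh i j 1 - frame Z i j 1) ≤ loss Zh Z := by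
  have hn0 : (0 : ℝ) < n := by exact_mod_cast hn
  refine le_ciInf fun B => ?_
  simp only [frobSq_frame_sub_frame, frobSq_sub_mul, Finset.sum_sub_distrib, ← Finset.mul_sum,
    ← frobInner_sum_right]
  rw [← frobInner_sum_left, ← frobInner_sum_left]
  set N := ∑ i, (Z i : Matrix (Fin d) (Fin d) ℝ).transpose * (Zh i : Matrix (Fin d) (Fin d) ℝ)
  have h := frobInner_self_nonneg ((1 / (n : ℝ)) • N - (B : Matrix (Fin d) (Fin d) ℝ))
  simp only [frobInner_sub_left, frobInner_sub_right, frobInner_smul_left, frobInner_smul_right,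
    frobInner_coe_coe] at h
  rw [frobInner_comm (B : Matrix (Fin d) (Fin d) ℝ) N] at h
  simp only [Finset.sum_const, Finset.card_univ, Fintype.card_fin, nsmul_eq_mul]
  have h1 : 1 / (2 * (n : ℝ) ^ 2) * (2 * (n * (n * d)) - 2 * frobInner N N) =
      d - 1 / n * (1 / n * frobInner N N) := by
    field_simp
  have h2 : 1 / (n : ℝ) * (2 * (n * d) - 2 * frobInner N (B : Matrix (Fin d) (Fin d) ℝ)) =
      2 * d - 2 * (1 / n * frobInner N (B : Matrix (Fin d) (Fin d) ℝ)) := by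
    field_simp
  rw [h2]
  refine le_of_eq_of_le h1 ?_
  linarith

end Loss

/-! ### Measurability and elementary bounds -/

section Measurability

variable {α : Type*} [MeasurableSpace α] {d : ℕ}

theorem measurable_matrix_mul {f g : α → Matrix (Fin d) (Fin d) ℝ} (hf : Measurable f)
    (hg : Measurable g) : Measurable fun x => f x * g x :=
  measurable_matrix fun a b => by
    simp only [Matrix.mul_apply]
    exact Finset.measurable_sum _ fun c _ =>
      ((measurable_entry a c).comp hf).mul ((measurable_entry c b).comp hg)

theorem measurable_matrix_transpose {f : α → Matrix (Fin d) (Fin d) ℝ} (hf : Measurable f) :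
    Measurable fun x => (f x).transpose :=
  measurable_matrix fun a b => (measurable_entry b a).comp hf

theorem measurable_matrix_sub {f g : α → Matrix (Fin d) (Fin d) ℝ} (hf : Measurable f)
    (hg : Measurable g) : Measurable fun x => f x - g x :=
  measurable_matrix fun a b => ((measurable_entry a b).comp hf).sub ((measurable_entry a b).comp hg)

theorem measurable_frame {n : ℕ} (i j : Fin n) (X : Matrix (Fin d) (Fin d) ℝ) :
    Measurable fun Z : Fin n → SO d => frame Z i j X := by
  have h : ∀ m, Measurable fun Z : Fin n → SO d => (Z m : Matrix (Fin d) (Fin d) ℝ) := fun m =>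
    measurable_subtype_coe.comp (measurable_pi_apply m)
  exact measurable_matrix_mul (measurable_matrix_mul (h i) measurable_const)
    (measurable_matrix_transpose (h j))

end Measurability

theorem abs_frobInner_le {d : ℕ} (X Y : Matrix (Fin d) (Fin d) ℝ) :
    |frobInner X Y| ≤ frobInner X X + frobInner Y Y := by
  have h1 := frobInner_self_nonneg (X + Y)
  have h2 := frobInner_self_nonneg (X - Y)
  simp only [frobInner_add_left, frobInner_add_right, frobInner_sub_left, frobInner_sub_right,
    frobInner_comm Y X] at h1 h2
  have h3 := frobInner_self_nonneg X
  have h4 := frobInner_self_nonneg Y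
  rw [abs_le]
  constructor <;> linarith

theorem frobInner_self_sub_le {d : ℕ} {X Y : Matrix (Fin d) (Fin d) ℝ}
    (hX : ∀ a b, |X a b| ≤ 1) (hY : ∀ a b, |Y a b| ≤ 1) :
    frobInner (X - Y) (X - Y) ≤ 4 * d * d := by
  have h : ∀ a b, (X - Y) a b * (X - Y) a b ≤ 4 := by
    intro a b
    have h1 := abs_le.1 (hX a b)
    have h2 := abs_le.1 (hY a b)
    rw [Matrix.sub_apply]
    nlinarith
  calc frobInner (X - Y) (X - Y) ≤ ∑ _a : Fin d, ∑ _b : Fin d, (4 : ℝ) :=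
        Finset.sum_le_sum fun a _ => Finset.sum_le_sum fun b _ => h a b
    _ = 4 * d * d := by
      simp
      ring

/-! ### The test matrix and its second moment -/

section VanTrees

variable {n d : ℕ} (σ : ℝ) (p : unitInterval) (i j : Fin n) (t : ℝ)

/-- The translation of the noise that has the effect of rotating the vertices `i` and `j`. -/
def noiseIncrement (k : Fin d × Fin d) (Z : Fin n → SO d) (e : Pairs n) :
    Matrix (Fin d) (Fin d) ℝ :=
  σ⁻¹ • frame Z e.1.1 e.1.2
    (givensMatrix k ((speed i j e.1.1 - speed i j e.1.2) * t) - 1)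

/-- All vertices rotate within one one-parameter group, so an edge sees only the relative angle, and
the change of its signal is absorbed into the noise. An absent edge shows 0 in both cases. -/
theorem observe_mul_rotatePair {σ : ℝ} (hσ : σ ≠ 0) (k : Fin d × Fin d) (Z : Fin n → SO d)
    (ω : Noise n d) :
    observe σ (Z * rotatePair i j k t) ω =
      observe σ Z (noiseShift (noiseIncrement σ i j t k Z) ω) := by
  funext e
  simp only [observe, noiseShift, edgeShift]
  refine Prod.ext rfl ?_
  by_cases h : (ω e).1 = true
  · simp only [h, if_true]
    rw [← frame_one, ← frame_one, frame_mul_rotatePair, mul_one, ← givensMatrix_add, smul_add,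
      noiseIncrement, smul_inv_smul₀ hσ, frame_sub, ← sub_eq_add_neg, ← sub_mul]
    abel
  · simp [h]

/-- The likelihood ratio of the rotation of the vertices `i` and `j`. -/
def ratio (k : Fin d × Fin d) (Z : Fin n → SO d) : Noise n d → ℝ :=
  noiseDensity (noiseIncrement σ i j t k Z)

/-- Z drops out because `frame` preserves inner products. -/
theorem integral_ratio_mul_ratio (k l : Fin d × Fin d) (Z : Fin n → SO d) :
    ∫ ω, ratio σ i j t k Z ω * ratio σ i j t l Z ω ∂noiseLaw n d p =
      ratioMoment σ p (fun e : Pairs n => speed i j e.1.1 - speed i j e.1.2) k l t := by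
  simp only [ratio, integral_noiseDensity_mul, ratioMoment, noiseIncrement, frobInner_smul_left,
    frobInner_smul_right, frobInner_frame_frame]
  refine Finset.prod_congr rfl fun e _ => ?_
  congr 4
  ring

/-- The test matrix: a difference quotient, in the directions of all the rotations of the vertices
`i` and `j`, of the density times the derivative of `Zᵢ Zⱼᵀ`. -/
def testMatrix (Z : Fin n → SO d) (ω : Noise n d) : Matrix (Fin d) (Fin d) ℝ :=
  ∑ k : Fin d × Fin d, t⁻¹ • (ratio σ i j t k Z ω • frame Z i j (skew k * givensMatrix k (2 * t)) -
    frame Z i j (skew k))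

theorem frobInner_testMatrix_self (Z : Fin n → SO d) (ω : Noise n d) :
    frobInner (testMatrix σ i j t Z ω) (testMatrix σ i j t Z ω) =
      ∑ k : Fin d × Fin d, ∑ l : Fin d × Fin d, t⁻¹ * (t⁻¹ *
        (ratio σ i j t k Z ω * ratio σ i j t l Z ω *
            frobInner (skew k * givensMatrix k (2 * t)) (skew l * givensMatrix l (2 * t)) -
          ratio σ i j t k Z ω * frobInner (skew k * givensMatrix k (2 * t)) (skew l) -
          ratio σ i j t l Z ω * frobInner (skew k) (skew l * givensMatrix l (2 * t)) +
          frobInner (skew k) (skew l))) := by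
  unfold testMatrix
  rw [frobInner_sum_left]
  refine Finset.sum_congr rfl fun k _ => ?_
  rw [frobInner_sum_right]
  refine Finset.sum_congr rfl fun l _ => ?_
  simp only [frobInner_smul_left, frobInner_smul_right, frobInner_sub_left, frobInner_sub_right,
    frobInner_frame_frame]
  ring

theorem integrable_frobInner_testMatrix_term (k l : Fin d × Fin d) (Z : Fin n → SO d)
    (a b c e : ℝ) :
    Integrable (fun ω => ratio σ i j t k Z ω * ratio σ i j t l Z ω * a -
      ratio σ i j t k Z ω * b - ratio σ i j t l Z ω * c + e) (noiseLaw n d p) :=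
  ((((integrable_noiseDensity_mul p _ _).mul_const a).sub
    ((integrable_noiseDensity p _).mul_const b)).sub
      ((integrable_noiseDensity p _).mul_const c)).add (integrable_const e)

theorem integrable_frobInner_testMatrix_self (Z : Fin n → SO d) :
    Integrable (fun ω => frobInner (testMatrix σ i j t Z ω) (testMatrix σ i j t Z ω))
      (noiseLaw n d p) := by
  simp only [frobInner_testMatrix_self]
  exact integrable_finsetSum _ fun k _ => integrable_finsetSum _ fun l _ =>
    ((integrable_frobInner_testMatrix_term σ p i j t k l Z _ _ _ _).const_mul _).const_mul _

theorem integral_frobInner_testMatrix_term (k l : Fin d × Fin d) (Z : Fin n → SO d)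
    (a b c e : ℝ) :
    ∫ ω, (ratio σ i j t k Z ω * ratio σ i j t l Z ω * a -
      ratio σ i j t k Z ω * b - ratio σ i j t l Z ω * c + e) ∂noiseLaw n d p =
      ratioMoment σ p (fun e : Pairs n => speed i j e.1.1 - speed i j e.1.2) k l t * a - b - c +
        e := by
  have h1 : Integrable (fun ω => ratio σ i j t k Z ω * ratio σ i j t l Z ω * a)
      (noiseLaw n d p) := (integrable_noiseDensity_mul p _ _).mul_const a
  have h2 : Integrable (fun ω => ratio σ i j t k Z ω * b) (noiseLaw n d p) :=
    (integrable_noiseDensity p _).mul_const b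
  have h3 : Integrable (fun ω => ratio σ i j t l Z ω * c) (noiseLaw n d p) :=
    (integrable_noiseDensity p _).mul_const c
  have h12 : Integrable (fun ω => ratio σ i j t k Z ω * ratio σ i j t l Z ω * a -
      ratio σ i j t k Z ω * b) (noiseLaw n d p) := h1.sub h2
  have h123 : Integrable (fun ω => ratio σ i j t k Z ω * ratio σ i j t l Z ω * a -
      ratio σ i j t k Z ω * b - ratio σ i j t l Z ω * c) (noiseLaw n d p) := h12.sub h3
  rw [integral_add h123 (integrable_const e), integral_sub h12 h3,
    integral_sub h1 h2, integral_mul_const, integral_mul_const, integral_mul_const]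
  have h4 : ∀ k, ∫ ω, ratio σ i j t k Z ω ∂noiseLaw n d p = 1 := fun k =>
    integral_noiseDensity p _
  rw [integral_ratio_mul_ratio, h4, h4]
  simp

/-- With Sₖ = `skew k` and Aₖ = `skew k * givensMatrix k (2 * t)`, and ratios rₖ of mean one, the
four terms regroup as (E[rₖrₗ] - 1)⟨Aₖ, Aₗ⟩ + ⟨Aₖ - Sₖ, Aₗ - Sₗ⟩. Both parts are of order t²,
matching the factor t⁻². -/
theorem integral_frobInner_testMatrix_self (Z : Fin n → SO d) :
    ∫ ω, frobInner (testMatrix σ i j t Z ω) (testMatrix σ i j t Z ω) ∂noiseLaw n d p =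
      testMoment d σ p (fun e : Pairs n => speed i j e.1.1 - speed i j e.1.2) t := by
  simp only [frobInner_testMatrix_self, testMoment]
  have h := fun k l => ((integrable_frobInner_testMatrix_term σ p i j t k l Z
    (frobInner (skew k * givensMatrix k (2 * t)) (skew l * givensMatrix l (2 * t)))
    (frobInner (skew k * givensMatrix k (2 * t)) (skew l))
    (frobInner (skew k) (skew l * givensMatrix l (2 * t)))
    (frobInner (skew k) (skew l))).const_mul t⁻¹).const_mul t⁻¹
  rw [integral_finsetSum _ fun k _ => integrable_finsetSum _ fun l _ => h k l]
  refine Finset.sum_congr rfl fun k _ => ?_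
  rw [integral_finsetSum _ fun l _ => h k l]
  refine Finset.sum_congr rfl fun l _ => ?_
  rw [integral_const_mul, integral_const_mul, integral_frobInner_testMatrix_term]
  simp only [mul_smul_comm, mul_sub, mul_one, frobInner_smul_left, frobInner_smul_right,
    frobInner_sub_left, frobInner_sub_right]
  ring

end VanTrees

theorem measurable_observe_right {n d : ℕ} (σ : ℝ) (Z : Fin n → SO d) :
    Measurable (observe σ Z : Noise n d → Obs n d) :=
  (measurable_observe σ).comp measurable_prodMk_left

theorem integrable_of_abs_le {α : Type*} [MeasurableSpace α] {μ : Measure α} [IsFiniteMeasure μ]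
    {f : α → ℝ} (hf : Measurable f) (C : ℝ) (h : ∀ x, |f x| ≤ C) : Integrable f μ :=
  Integrable.of_bound hf.aestronglyMeasurable C (Eventually.of_forall h)

/-! ### Discrete integration by parts -/

section Correlation

variable {n d : ℕ} (σ : ℝ) (p : unitInterval) (i j : Fin n) (t : ℝ)
  {T : Obs n d → Matrix (Fin d) (Fin d) ℝ}

/-- The mean inner product of the error of the estimator `T` of `Zᵢ Zⱼᵀ` with a tangent vector at
`Zᵢ Zⱼᵀ`. -/
def correlation (T : Obs n d → Matrix (Fin d) (Fin d) ℝ) (k : Fin d × Fin d) (Z : Fin n → SO d) :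
    ℝ :=
  ∫ ω, frobInner (T (observe σ Z ω) - frame Z i j 1) (frame Z i j (skew k)) ∂noiseLaw n d p

theorem measurable_frobInner_error (hT : Measurable T) (Z : Fin n → SO d)
    (A E : Matrix (Fin d) (Fin d) ℝ) :
    Measurable fun ω : Noise n d => frobInner (T (observe σ Z ω) - A) E :=
  measurable_frobInner (measurable_matrix_sub (hT.comp (measurable_observe_right σ Z))
    measurable_const) measurable_const

theorem abs_frobInner_error_le (hTb : ∀ y a b, |T y a b| ≤ 1) (y : Obs n d) (Z : Fin n → SO d)
    (E : Matrix (Fin d) (Fin d) ℝ) :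
    |frobInner (T y - frame Z i j 1) E| ≤ 4 * d * d + frobInner E E :=
  (abs_frobInner_le _ _).trans (add_le_add_left
    (frobInner_self_sub_le (hTb y) (abs_frame_one_le Z i j)) _)

theorem integrable_frobInner_error (hT : Measurable T) (hTb : ∀ y a b, |T y a b| ≤ 1)
    (Z : Fin n → SO d) (E : Matrix (Fin d) (Fin d) ℝ) :
    Integrable (fun ω => frobInner (T (observe σ Z ω) - frame Z i j 1) E) (noiseLaw n d p) :=
  integrable_of_abs_le (measurable_frobInner_error σ hT Z _ _) _
    fun _ => abs_frobInner_error_le i j hTb _ Z E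

theorem integrable_ratio_mul_frobInner_error (hT : Measurable T) (hTb : ∀ y a b, |T y a b| ≤ 1)
    (k : Fin d × Fin d) (Z : Fin n → SO d) (E : Matrix (Fin d) (Fin d) ℝ) :
    Integrable (fun ω => ratio σ i j t k Z ω *
      frobInner (T (observe σ Z ω) - frame Z i j 1) E) (noiseLaw n d p) :=
  (integrable_noiseDensity p _).mul_bdd
    (measurable_frobInner_error σ hT Z _ _).aestronglyMeasurable
    (Eventually.of_forall fun _ => abs_frobInner_error_le i j hTb _ Z E)

theorem frame_mul_rotatePair_self {i j : Fin n} (hij : i ≠ j) (k : Fin d × Fin d)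
    (Z : Fin n → SO d) (X : Matrix (Fin d) (Fin d) ℝ) :
    frame (Z * rotatePair i j k t) i j X =
      frame Z i j (givensMatrix k t * X * givensMatrix k t) := by
  rw [frame_mul_rotatePair]
  simp [speed, hij, hij.symm]

/-- The ratio moves the parameter to the rotated one. The tangent vector there is the one in the
integrand, as the generator commutes with its rotations; the target has moved to Zᵢ Gₖ(2t) Zⱼᵀ, Gₖ
being the plane rotation, which gives the additional term. -/
theorem integral_ratio_mul_frobInner_error {σ : ℝ} (hσ : σ ≠ 0) {i j : Fin n} (hij : i ≠ j)
    (hT : Measurable T) (hTb : ∀ y a b, |T y a b| ≤ 1) (k : Fin d × Fin d) (Z : Fin n → SO d) :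
    ∫ ω, ratio σ i j t k Z ω * frobInner (T (observe σ Z ω) - frame Z i j 1)
        (frame Z i j (skew k * givensMatrix k (2 * t))) ∂noiseLaw n d p =
      correlation σ p i j T k (Z * rotatePair i j k t) +
        frobInner (givensMatrix k (2 * t) - 1) (skew k * givensMatrix k (2 * t)) := by
  have hE : frame (Z * rotatePair i j k t) i j (skew k) =
      frame Z i j (skew k * givensMatrix k (2 * t)) := by
    rw [frame_mul_rotatePair_self t hij, ← skew_mul_givensMatrix, mul_assoc, ← givensMatrix_add,
      two_mul]
  have hψ : frame (Z * rotatePair i j k t) i j 1 = frame Z i j (givensMatrix k (2 * t)) := by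
    rw [frame_mul_rotatePair_self t hij, mul_one, ← givensMatrix_add, two_mul]
  have hcm : correlation σ p i j T k (Z * rotatePair i j k t) =
      ∫ ω, ratio σ i j t k Z ω * frobInner (T (observe σ Z ω) -
        frame Z i j (givensMatrix k (2 * t)))
          (frame Z i j (skew k * givensMatrix k (2 * t))) ∂noiseLaw n d p := by
    simp only [correlation, hE, hψ, observe_mul_rotatePair i j t hσ]
    exact integral_comp_noiseShift p _ (measurable_frobInner_error σ hT Z _ _)
  have hsplit : ∀ ω, ratio σ i j t k Z ω * frobInner (T (observe σ Z ω) -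
        frame Z i j (givensMatrix k (2 * t))) (frame Z i j (skew k * givensMatrix k (2 * t))) =
      ratio σ i j t k Z ω * frobInner (T (observe σ Z ω) - frame Z i j 1)
        (frame Z i j (skew k * givensMatrix k (2 * t))) -
      ratio σ i j t k Z ω *
        frobInner (givensMatrix k (2 * t) - 1) (skew k * givensMatrix k (2 * t)) := by
    intro ω
    simp only [frobInner_sub_left, frobInner_frame_frame]
    ring
  have h1 : ∫ ω, ratio σ i j t k Z ω ∂noiseLaw n d p = 1 := integral_noiseDensity p _
  have h2 : Integrable (ratio σ i j t k Z) (noiseLaw n d p) := integrable_noiseDensity p _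
  rw [hcm]
  simp_rw [hsplit]
  rw [integral_sub (integrable_ratio_mul_frobInner_error σ p i j t hT hTb k Z _)
    (h2.mul_const _), integral_mul_const, h1]
  ring

theorem frobInner_testMatrix_right (X : Matrix (Fin d) (Fin d) ℝ) (Z : Fin n → SO d)
    (ω : Noise n d) :
    frobInner X (testMatrix σ i j t Z ω) = ∑ k : Fin d × Fin d, t⁻¹ *
      (ratio σ i j t k Z ω * frobInner X (frame Z i j (skew k * givensMatrix k (2 * t))) -
        frobInner X (frame Z i j (skew k))) := by
  simp only [testMatrix, frobInner_sum_right, frobInner_smul_right, frobInner_sub_right]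

theorem integrable_frobInner_error_testMatrix (hT : Measurable T)
    (hTb : ∀ y a b, |T y a b| ≤ 1) (Z : Fin n → SO d) :
    Integrable (fun ω => frobInner (T (observe σ Z ω) - frame Z i j 1) (testMatrix σ i j t Z ω))
      (noiseLaw n d p) := by
  simp only [frobInner_testMatrix_right]
  exact integrable_finsetSum _ fun k _ =>
    ((integrable_ratio_mul_frobInner_error σ p i j t hT hTb k Z _).sub
      (integrable_frobInner_error σ p i j hT hTb Z _)).const_mul _

/-- The estimator enters only through exact increments along right translations, which a
right-invariant prior averages to zero. -/
theorem integral_frobInner_error_testMatrix {σ : ℝ} (hσ : σ ≠ 0) {i j : Fin n} (hij : i ≠ j)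
    (hT : Measurable T) (hTb : ∀ y a b, |T y a b| ≤ 1) (Z : Fin n → SO d) :
    ∫ ω, frobInner (T (observe σ Z ω) - frame Z i j 1) (testMatrix σ i j t Z ω) ∂noiseLaw n d p =
      ∑ k : Fin d × Fin d, t⁻¹ * (correlation σ p i j T k (Z * rotatePair i j k t) -
        correlation σ p i j T k Z) + testMean d t := by
  simp only [frobInner_testMatrix_right]
  have h1 := fun k => integrable_ratio_mul_frobInner_error σ p i j t hT hTb k Z
    (frame Z i j (skew k * givensMatrix k (2 * t)))
  have h2 := fun k => integrable_frobInner_error σ p i j hT hTb Z (frame Z i j (skew k))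
  have h3 : ∀ k, Integrable (fun ω => t⁻¹ * (ratio σ i j t k Z ω *
      frobInner (T (observe σ Z ω) - frame Z i j 1)
        (frame Z i j (skew k * givensMatrix k (2 * t))) -
      frobInner (T (observe σ Z ω) - frame Z i j 1) (frame Z i j (skew k))))
      (noiseLaw n d p) := fun k => ((h1 k).sub (h2 k)).const_mul _
  rw [integral_finsetSum _ fun k _ => h3 k, testMean,
    ← Finset.sum_add_distrib]
  refine Finset.sum_congr rfl fun k _ => ?_
  rw [integral_const_mul, integral_sub (h1 k) (h2 k),
    integral_ratio_mul_frobInner_error p t hσ hij hT hTb, frobInner_smul_left]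
  simp only [correlation]
  ring

theorem measurable_correlation (hT : Measurable T) (k : Fin d × Fin d) :
    Measurable (correlation σ p i j T k) := by
  have h : Measurable fun q : (Fin n → SO d) × Noise n d =>
      frobInner (T (observe σ q.1 q.2) - frame q.1 i j 1) (frame q.1 i j (skew k)) :=
    measurable_frobInner (measurable_matrix_sub (hT.comp (measurable_observe σ))
      ((measurable_frame i j 1).comp measurable_fst))
      ((measurable_frame i j (skew k)).comp measurable_fst)
  exact (h.stronglyMeasurable.integral_prod_right' (ν := noiseLaw n d p)).measurable

theorem abs_correlation_le (hTb : ∀ y a b, |T y a b| ≤ 1) (k : Fin d × Fin d)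
    (Z : Fin n → SO d) :
    |correlation σ p i j T k Z| ≤ 4 * d * d + frobInner (skew k) (skew k) := by
  have h := norm_integral_le_of_norm_le_const (μ := noiseLaw n d p)
    (f := fun ω => frobInner (T (observe σ Z ω) - frame Z i j 1) (frame Z i j (skew k)))
    (C := 4 * d * d + frobInner (skew k) (skew k)) (Eventually.of_forall fun ω => by
      simpa only [Real.norm_eq_abs, frobInner_frame_frame] using
        abs_frobInner_error_le i j hTb (observe σ Z ω) Z (frame Z i j (skew k)))
  simpa [correlation] using h

theorem integrable_correlation (hT : Measurable T) (hTb : ∀ y a b, |T y a b| ≤ 1)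
    (k : Fin d × Fin d) (π : Measure (Fin n → SO d)) [IsFiniteMeasure π] :
    Integrable (correlation σ p i j T k) π :=
  integrable_of_abs_le (measurable_correlation σ p i j hT k) _
    (abs_correlation_le σ p i j hTb k)

end Correlation

/-! ### Randomized estimators and the pairwise risk -/

section PairRisk

variable {n d : ℕ} (σ : ℝ) (p : unitInterval) (i j : Fin n) (t : ℝ)
  (κ : Kernel (Obs n d) (Fin n → SO d))

/-- The conditional mean of the estimator of `Zᵢ Zⱼᵀ` given the data. -/
def meanEstimator (y : Obs n d) : Matrix (Fin d) (Fin d) ℝ :=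
  Matrix.of fun a b => ∫ Zh, frame Zh i j 1 a b ∂κ y

theorem measurable_meanEstimator : Measurable (meanEstimator i j κ) :=
  measurable_matrix fun a b =>
    (((measurable_entry a b).comp
      (measurable_frame i j 1)).stronglyMeasurable.integral_kernel (κ := κ)).measurable

variable [IsMarkovKernel κ]

theorem abs_meanEstimator_le (y : Obs n d) (a b : Fin d) : |meanEstimator i j κ y a b| ≤ 1 := by
  have h := norm_integral_le_of_norm_le_const (μ := κ y) (f := fun Zh => frame Zh i j 1 a b)
    (C := 1) (Eventually.of_forall fun Zh => abs_frame_one_le Zh i j a b)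
  simpa [meanEstimator] using h

theorem integral_frobInner_frame (y : Obs n d) (E : Matrix (Fin d) (Fin d) ℝ) :
    ∫ Zh, frobInner (frame Zh i j 1) E ∂κ y = frobInner (meanEstimator i j κ y) E := by
  have h : ∀ a b, Integrable (fun Zh => frame Zh i j 1 a b * E a b) (κ y) := fun a b =>
    (integrable_of_abs_le ((measurable_entry a b).comp (measurable_frame i j 1)) 1
      fun Zh => abs_frame_one_le Zh i j a b).mul_const _
  simp only [frobInner]
  rw [integral_finsetSum _ fun a _ => integrable_finsetSum _ fun b _ => h a b]
  refine Finset.sum_congr rfl fun a _ => ?_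
  rw [integral_finsetSum _ fun b _ => h a b]
  refine Finset.sum_congr rfl fun b _ => ?_
  rw [integral_mul_const]
  rfl

theorem measurable_frobSq_frame_sub (A : Matrix (Fin d) (Fin d) ℝ) :
    Measurable fun Zh : Fin n → SO d => frobSq (frame Zh i j 1 - A) := by
  simp only [frobSq_eq_frobInner]
  exact measurable_frobInner (measurable_matrix_sub (measurable_frame i j 1) measurable_const)
    (measurable_matrix_sub (measurable_frame i j 1) measurable_const)

theorem frobSq_nonneg (A : Matrix (Fin d) (Fin d) ℝ) : 0 ≤ frobSq A := by
  rw [frobSq_eq_frobInner]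
  exact frobInner_self_nonneg A

theorem abs_frobSq_frame_sub_frame_le (Zh Z : Fin n → SO d) :
    |frobSq (frame Zh i j 1 - frame Z i j 1)| ≤ 4 * d * d := by
  rw [abs_of_nonneg (frobSq_nonneg _), frobSq_eq_frobInner]
  exact frobInner_self_sub_le (abs_frame_one_le Zh i j) (abs_frame_one_le Z i j)

theorem integrable_frobSq_frame_sub_frame (Z : Fin n → SO d) (μ : Measure (Fin n → SO d))
    [IsFiniteMeasure μ] :
    Integrable (fun Zh => frobSq (frame Zh i j 1 - frame Z i j 1)) μ :=
  integrable_of_abs_le (measurable_frobSq_frame_sub i j _) _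
    fun Zh => abs_frobSq_frame_sub_frame_le i j Zh Z

/-- Integrate |X - cG|² ≥ 0 over the randomization. The lower bound is affine in the estimate, so
only its conditional mean matters; that mean may leave the rotation group, but only the bound on its
entries is needed later. -/
theorem le_integral_frobSq (c : ℝ) (y : Obs n d) (Z : Fin n → SO d)
    (G : Matrix (Fin d) (Fin d) ℝ) :
    2 * c * frobInner (meanEstimator i j κ y - frame Z i j 1) G - c ^ 2 * frobInner G G ≤
      ∫ Zh, frobSq (frame Zh i j 1 - frame Z i j 1) ∂κ y := by
  have hG : Integrable (fun Zh => frobInner (frame Zh i j 1) G) (κ y) :=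
    integrable_of_abs_le (measurable_frobInner (measurable_frame i j 1) measurable_const)
      (frobInner 1 1 + frobInner G G) fun Zh => by
        simpa only [frobInner_frame_frame] using abs_frobInner_le (frame Zh i j 1) G
  have h2 : Integrable (fun Zh => 2 * c * frobInner (frame Zh i j 1) G -
      (2 * c * frobInner (frame Z i j 1) G + c ^ 2 * frobInner G G)) (κ y) :=
    (hG.const_mul _).sub (integrable_const _)
  calc _ = ∫ Zh, (2 * c * frobInner (frame Zh i j 1) G -
        (2 * c * frobInner (frame Z i j 1) G + c ^ 2 * frobInner G G)) ∂κ y := by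
        rw [integral_sub (hG.const_mul _) (integrable_const _), integral_const_mul,
          integral_frobInner_frame, frobInner_sub_left]
        simp
        ring
    _ ≤ _ := by
        refine integral_mono h2 (integrable_frobSq_frame_sub_frame i j Z _) fun Zh => ?_
        have h := frobInner_self_nonneg (frame Zh i j 1 - frame Z i j 1 - c • G)
        rw [frobSq_eq_frobInner]
        set X := frame Zh i j 1
        set Y := frame Z i j 1
        simp only [frobInner_sub_left, frobInner_sub_right, frobInner_smul_left,
          frobInner_smul_right] at h ⊢
        rw [frobInner_comm G X, frobInner_comm G Y] at h
        linarith

instance isMarkovKernel_model : IsMarkovKernel (model n d σ p) where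
  isProbabilityMeasure Z :=
    Measure.isProbabilityMeasure_map (measurable_observe_right σ Z).aemeasurable

theorem integral_comp_model {f : (Fin n → SO d) → ℝ} (hf : Measurable f) (C : ℝ)
    (hC : ∀ Zh, |f Zh| ≤ C) (Z : Fin n → SO d) :
    ∫ Zh, f Zh ∂(κ ∘ₖ model n d σ p) Z =
      ∫ ω, ∫ Zh, f Zh ∂κ (observe σ Z ω) ∂noiseLaw n d p := by
  rw [Kernel.integral_comp (integrable_of_abs_le hf C hC)]
  exact integral_map (measurable_observe_right σ Z).aemeasurable
    (hf.stronglyMeasurable.integral_kernel (κ := κ)).aestronglyMeasurable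

theorem le_integral_frobSq_comp_model {σ : ℝ} (hσ : σ ≠ 0) {i j : Fin n} (hij : i ≠ j) (c : ℝ)
    (Z : Fin n → SO d) :
    2 * c * (∑ k : Fin d × Fin d, t⁻¹ *
        (correlation σ p i j (meanEstimator i j κ) k (Z * rotatePair i j k t) -
          correlation σ p i j (meanEstimator i j κ) k Z) + testMean d t) -
      c ^ 2 * testMoment d σ p (fun e : Pairs n => speed i j e.1.1 - speed i j e.1.2) t ≤
      ∫ Zh, frobSq (frame Zh i j 1 - frame Z i j 1) ∂(κ ∘ₖ model n d σ p) Z := by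
  have h1 := integrable_frobInner_error_testMatrix σ p i j t (measurable_meanEstimator i j κ)
    (abs_meanEstimator_le i j κ) Z
  have h2 := integrable_frobInner_testMatrix_self σ p i j t Z
  rw [integral_comp_model σ p κ (measurable_frobSq_frame_sub i j _) _
      (fun Zh => abs_frobSq_frame_sub_frame_le i j Zh Z),
    ← integral_frobInner_error_testMatrix p t hσ hij (measurable_meanEstimator i j κ)
      (abs_meanEstimator_le i j κ) Z, ← integral_frobInner_testMatrix_self σ p i j t Z,
    ← integral_const_mul, ← integral_const_mul, ← integral_sub (h1.const_mul _) (h2.const_mul _)]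
  refine integral_mono ((h1.const_mul _).sub (h2.const_mul _)) ?_
    fun ω => le_integral_frobSq i j κ c _ Z _
  refine integrable_of_abs_le ((measurable_frobSq_frame_sub i j
    _).stronglyMeasurable.integral_kernel.measurable.comp (measurable_observe_right σ Z))
      (4 * d * d) fun ω => ?_
  have h := norm_integral_le_of_norm_le_const (μ := κ (observe σ Z ω))
    (f := fun Zh => frobSq (frame Zh i j 1 - frame Z i j 1))
    (C := 4 * d * d) (Eventually.of_forall fun Zh => abs_frobSq_frame_sub_frame_le i j Zh Z)
  simpa using h

end PairRisk

/-! ### Haar averaging, passage to the limit and choice of the multiplier -/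

section Minimax

variable {n d : ℕ} {σ : ℝ} (p : unitInterval) (c t : ℝ)
  (κ : Kernel (Obs n d) (Fin n → SO d)) [IsMarkovKernel κ]

/-- The van Trees lower bound with step `t` and multiplier `c` for the sum of the risks of
estimation of `Zᵢ Zⱼᵀ`. -/
def stepBound (n d : ℕ) (σ : ℝ) (p : unitInterval) (c t : ℝ) : ℝ :=
  ∑ i : Fin n, ∑ j : Fin n, if i = j then 0 else 2 * c * testMean d t -
    c ^ 2 * testMoment d σ p (fun e : Pairs n => speed i j e.1.1 - speed i j e.1.2) t

/-- One prior on the whole product group serves all pairs simultaneously, so a single Z reaches the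
average of the summed bounds. -/
theorem exists_stepBound_le (hσ : σ ≠ 0) :
    ∃ Z : Fin n → SO d, stepBound n d σ p c t ≤
      ∑ i, ∑ j, ∫ Zh, frobSq (frame Zh i j 1 - frame Z i j 1) ∂(κ ∘ₖ model n d σ p) Z := by
  obtain ⟨π, hπ, hinv⟩ := exists_isProbabilityMeasure_isMulRightInvariant (Fin n → SO d)
  let m : Fin n → Fin n → Fin d × Fin d → (Fin n → SO d) → ℝ := fun i j k =>
    correlation σ p i j (meanEstimator i j κ) k
  have hm : ∀ i j k, Integrable (m i j k) π := fun i j k =>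
    integrable_correlation σ p i j (measurable_meanEstimator i j κ)
      (abs_meanEstimator_le i j κ) k π
  let g : Fin n → Fin n → (Fin n → SO d) → ℝ := fun i j Z =>
    ∑ k : Fin d × Fin d, t⁻¹ * (m i j k (Z * rotatePair i j k t) - m i j k Z)
  have hg1 : ∀ i j k, Integrable
      (fun Z => t⁻¹ * (m i j k (Z * rotatePair i j k t) - m i j k Z)) π := fun i j k =>
    (((hm i j k).comp_mul_right _).sub (hm i j k)).const_mul _
  have hg : ∀ i j, Integrable (g i j) π := fun i j => integrable_finsetSum _ fun k _ => hg1 i j k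
  have hg0 : ∀ i j, ∫ Z, g i j Z ∂π = 0 := by
    intro i j
    rw [integral_finsetSum _ fun k _ => hg1 i j k]
    refine Finset.sum_eq_zero fun k _ => ?_
    -- By right-invariance the translated correlation has the same mean as the original.
    rw [integral_const_mul, integral_sub ((hm i j k).comp_mul_right _) (hm i j k),
      integral_mul_right_eq_self, sub_self, mul_zero]
  let V : Fin n → Fin n → ℝ := fun i j =>
    testMoment d σ p (fun e : Pairs n => speed i j e.1.1 - speed i j e.1.2) t
  let f : Fin n → Fin n → (Fin n → SO d) → ℝ := fun i j Z =>
    if i = j then 0 else 2 * c * (g i j Z + testMean d t) - c ^ 2 * V i j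
  have hf : ∀ i j, Integrable (f i j) π := by
    intro i j
    by_cases hij : i = j
    · simp [f, hij]
    · simp only [f, hij, if_false]
      exact (((hg i j).add (integrable_const _)).const_mul _).sub (integrable_const _)
  have hf0 : ∀ i j, ∫ Z, f i j Z ∂π =
      if i = j then 0 else 2 * c * testMean d t - c ^ 2 * V i j := by
    intro i j
    by_cases hij : i = j
    · simp [f, hij]
    · simp only [f, hij, if_false]
      have h1 : Integrable (fun Z => 2 * c * (g i j Z + testMean d t)) π :=
        ((hg i j).add (integrable_const _)).const_mul _
      rw [integral_sub h1 (integrable_const _), integral_const_mul,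
        integral_add (hg i j) (integrable_const _), hg0]
      simp
  obtain ⟨Z, hZ⟩ := exists_integral_le (μ := π) (f := fun Z => ∑ i, ∑ j, f i j Z)
    (integrable_finsetSum _ fun i _ => integrable_finsetSum _ fun j _ => hf i j)
  refine ⟨Z, ?_⟩
  rw [integral_finsetSum _ fun i _ => integrable_finsetSum _ fun j _ => hf i j] at hZ
  simp_rw [integral_finsetSum _ fun j _ => hf _ j, hf0] at hZ
  refine hZ.trans (Finset.sum_le_sum fun i _ => Finset.sum_le_sum fun j _ => ?_)
  by_cases hij : i = j
  · simp only [f, hij, if_true]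
    exact integral_nonneg fun Zh => frobSq_nonneg _
  · simp only [f, hij, if_false]
    exact le_integral_frobSq_comp_model p t κ hσ hij c Z

theorem ofReal_stepBound_le_risk (hn : 1 ≤ n) (hσ : σ ≠ 0) :
    ENNReal.ofReal (1 / (2 * (n : ℝ) ^ 2) * stepBound n d σ p c t) ≤ risk n d σ p := by
  refine le_iInf₂ fun κ hκ => ?_
  obtain ⟨Z, hZ⟩ := exists_stepBound_le (d := d) p c t κ hσ
  refine le_iSup_of_le Z ?_
  set Q := (κ ∘ₖ model n d σ p) Z
  have hi : ∀ i j, Integrable (fun Zh => frobSq (frame Zh i j 1 - frame Z i j 1)) Q := fun i j =>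
    integrable_frobSq_frame_sub_frame i j Z Q
  have hI : Integrable (fun Zh => 1 / (2 * (n : ℝ) ^ 2) *
      ∑ i, ∑ j, frobSq (frame Zh i j 1 - frame Z i j 1)) Q :=
    (integrable_finsetSum _ fun i _ => integrable_finsetSum _ fun j _ => hi i j).const_mul _
  calc ENNReal.ofReal (1 / (2 * (n : ℝ) ^ 2) * stepBound n d σ p c t)
      ≤ ENNReal.ofReal (∫ Zh, 1 / (2 * (n : ℝ) ^ 2) *
          ∑ i, ∑ j, frobSq (frame Zh i j 1 - frame Z i j 1) ∂Q) := by
        refine ENNReal.ofReal_le_ofReal ?_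
        rw [integral_const_mul,
          integral_finsetSum _ fun i _ => integrable_finsetSum _ fun j _ => hi i j]
        simp_rw [integral_finsetSum _ fun j _ => hi _ j]
        exact mul_le_mul_of_nonneg_left hZ (by positivity)
    _ = ∫⁻ Zh, ENNReal.ofReal (1 / (2 * (n : ℝ) ^ 2) *
          ∑ i, ∑ j, frobSq (frame Zh i j 1 - frame Z i j 1)) ∂Q :=
        ofReal_integral_eq_lintegral_ofReal hI (Eventually.of_forall fun Zh =>
          mul_nonneg (by positivity) (Finset.sum_nonneg fun i _ =>
            Finset.sum_nonneg fun j _ => frobSq_nonneg _))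
    _ ≤ _ := lintegral_mono fun Zh => ENNReal.ofReal_le_ofReal (pairLoss_le_loss Zh Z hn)

theorem tendsto_stepBound (n d : ℕ) (σ : ℝ) (p : unitInterval) (c : ℝ) :
    Tendsto (stepBound n d σ p c) (𝓝[≠] 0) (𝓝 (n * (n - 1) * (2 * c * (4 * d * (d - 1)) -
      c ^ 2 * (p * (2 * n) / σ ^ 2 * (8 * d * (d - 1)) + 16 * d * (d - 1) ^ 2)))) := by
  set L : ℝ := 2 * c * (4 * d * (d - 1)) -
      c ^ 2 * (p * (2 * n) / σ ^ 2 * (8 * d * (d - 1)) + 16 * d * (d - 1) ^ 2) with hL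
  have hsum : (n : ℝ) * (n - 1) * L = ∑ i : Fin n, ∑ j : Fin n, if i = j then 0 else L := by
    have h : ∀ i j : Fin n, (if i = j then 0 else L) = L - if i = j then L else 0 := by
      intro i j
      split_ifs <;> simp
    simp only [h, Finset.sum_sub_distrib, Finset.sum_ite_eq, Finset.mem_univ, if_true]
    simp
    ring
  rw [hsum]
  refine tendsto_finsetSum _ fun i _ => tendsto_finsetSum _ fun j _ => ?_
  by_cases hij : i = j
  · simp [hij]
  · simp only [hij, if_false]
    rw [hL, ← sum_speed_sub_speed_sq hij]
    exact ((tendsto_testMean d).const_mul _).sub ((tendsto_testMoment d σ p _).const_mul _)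

/-- The risk does not depend on the step, so the bound survives t → 0. -/
theorem ofReal_le_risk (hn : 1 ≤ n) (hσ : σ ≠ 0) :
    ENNReal.ofReal (1 / (2 * (n : ℝ) ^ 2) * (n * (n - 1) * (2 * c * (4 * d * (d - 1)) -
      c ^ 2 * (p * (2 * n) / σ ^ 2 * (8 * d * (d - 1)) + 16 * d * (d - 1) ^ 2)))) ≤
      risk n d σ p :=
  le_of_tendsto' ((ENNReal.continuous_ofReal.tendsto _).comp
    ((tendsto_stepBound n d σ p c).const_mul _)) fun t => ofReal_stepBound_le_risk p c t hn hσ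

theorem ofReal_one_sub_mul_le_risk (hn : 1 ≤ n) (hd : 2 ≤ d) (hσ : 0 < σ)
    (hp : 0 < (p : ℝ)) {C : ℝ} (hC : (d : ℝ) ≤ C) :
    ENNReal.ofReal ((1 - C * (1 / (n : ℝ) + σ ^ 2 / ((n : ℝ) * p))) *
      (σ ^ 2 * (d : ℝ) * ((d : ℝ) - 1) / (2 * (n : ℝ) * p))) ≤ risk n d σ p := by
  have hn1 : (1 : ℝ) ≤ n := by exact_mod_cast hn
  have hn0 : (0 : ℝ) < n := by linarith
  have hd2 : (2 : ℝ) ≤ d := by exact_mod_cast hd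
  set x : ℝ := σ ^ 2 / (n * p) with hx
  have hx0 : 0 < x := by positivity
  have hD : 0 < 1 + ((d : ℝ) - 1) * x := by nlinarith
  -- The multiplier is M/V, the maximizer of 2cM - c²V for the limits M = 4d(d-1) and V =
  -- 16d(d-1)(1+(d-1)x)/x.
  refine le_trans (ENNReal.ofReal_le_ofReal ?_)
    (ofReal_le_risk p (x / (4 * (1 + ((d : ℝ) - 1) * x))) hn hσ.ne')
  have hpx : (p : ℝ) * (2 * n) / σ ^ 2 = 2 / x := by
    rw [hx]
    field_simp
  have hsx : σ ^ 2 * (d : ℝ) * ((d : ℝ) - 1) / (2 * (n : ℝ) * p) = d * (d - 1) * x / 2 := by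
    rw [hx]
    field_simp
  have hval : 1 / (2 * (n : ℝ) ^ 2) * (n * (n - 1) * (2 * (x / (4 * (1 + ((d : ℝ) - 1) * x))) *
      (4 * d * (d - 1)) - (x / (4 * (1 + ((d : ℝ) - 1) * x))) ^ 2 *
        (2 / x * (8 * d * (d - 1)) + 16 * d * (d - 1) ^ 2))) =
      (1 - 1 / n) * (1 / (1 + ((d : ℝ) - 1) * x)) * (d * (d - 1) * x / 2) := by
    have hV : 2 / x * (8 * (d : ℝ) * (d - 1)) + 16 * d * (d - 1) ^ 2 =
        16 * d * (d - 1) / x * (1 + ((d : ℝ) - 1) * x) := by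
      field_simp
      ring
    rw [hV]
    generalize 1 + ((d : ℝ) - 1) * x = D at hD ⊢
    field_simp
    ring
  rw [hpx, hsx, hval]
  refine mul_le_mul_of_nonneg_right ?_ (by
    have : (0 : ℝ) ≤ d - 1 := by linarith
    positivity)
  have h1 : 1 - ((d : ℝ) - 1) * x ≤ 1 / (1 + ((d : ℝ) - 1) * x) := by
    rw [le_div_iff₀ hD]
    nlinarith [sq_nonneg (((d : ℝ) - 1) * x)]
  have hu : 0 ≤ 1 - 1 / (n : ℝ) := by
    rw [sub_nonneg, div_le_one hn0]
    exact hn1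
  have hu0 : 0 < 1 / (n : ℝ) := by positivity
  -- Expanding the right side leaves a nonnegative cross term; what remains needs only C ≥ 1 and C ≥
  -- d - 1, both implied by C ≥ d ≥ 2.
  calc 1 - C * (1 / (n : ℝ) + x) ≤ (1 - 1 / n) * (1 - ((d : ℝ) - 1) * x) := by
        have h2 : 1 / (n : ℝ) ≤ C * (1 / n) := le_mul_of_one_le_left hu0.le (by linarith)
        have h3 : ((d : ℝ) - 1) * x ≤ C * x := mul_le_mul_of_nonneg_right (by linarith) hx0.le
        have h4 : 0 ≤ 1 / (n : ℝ) * (((d : ℝ) - 1) * x) :=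
          mul_nonneg hu0.le (mul_nonneg (by linarith) hx0.le)
        linarith
    _ ≤ _ := mul_le_mul_of_nonneg_left h1 hu

end Minimax

end RotSync

end

theorem mainTheorem5 :
    ∃ c : ℝ, 0 < c ∧ ∀ C₁ : ℝ, 0 < C₁ → ∃ C : ℝ, 0 < C ∧
      ∀ (n d : ℕ) (σ : ℝ) (p : unitInterval),
        1 ≤ n → 2 ≤ d → (d : ℝ) ≤ C₁ → 0 < σ → c ≤ (n : ℝ) * p / σ ^ 2 →
        ENNReal.ofReal ((1 - C * (1 / (n : ℝ) + σ ^ 2 / ((n : ℝ) * p))) *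
            (σ ^ 2 * (d : ℝ) * ((d : ℝ) - 1) / (2 * (n : ℝ) * p)))
          ≤ RotSync.risk n d σ p := by
  -- The threshold 1 serves only to exclude p = 0, where the signal-to-noise quotient is 0; any
  -- positive value would do. The bound d ≤ C₁ makes C = C₁ large enough.
  refine ⟨1, one_pos, fun C₁ hC₁ => ⟨C₁, hC₁, fun n d σ p hn hd hdC hσ hc => ?_⟩⟩
  have hp : 0 < (p : ℝ) := by
    refine lt_of_le_of_ne p.2.1 fun h => ?_
    rw [← h] at hc
    norm_num at hc
  exact RotSync.ofReal_one_sub_mul_le_risk p hn hd hσ hp hdC
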